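/- Fix the following setting. Let $0<\alpha<1$, and let $0=t_0<t_1<t_2<\cdots$ be an arbitrary grid with finitely many points $t_0,\dots,t_N$ or with infinitely many points ($N=\infty$); put $\tau_n=t_n-t_{n-1}$. Below, $n$ ranges over the grid indices $n\le N$. For a lower triangular array of real numbers $C=(c_{n-j}^n)_{1\le j\le n}$ put $$\mathcal D_\tau^\alpha u_n=\sum_{j=1}^n c_{n-j}^n\,(u_j-u_{j-1}),\qquad n\ge1 .$$ Arrays are multiplied as lower triangular matrices, $(A\,\bar*\,B)_{n-k}^n=\sum_{j=k}^n a_{n-j}^n b_{j-k}^j$. The scheme is called completely positive if there is an invertible array $A$ such that all (lower triangular) entries of $A\,\bar*\,C$ are equal to $1$ and the inverse $B=(b_{n-j}^n)$ of $A$ satisfies, for all $n\ge1$, $b_0^n>0$, $b_{n-j}^n\le0$ for $1\le j<n$, and $\sum_{j=1}^n b_{n-j}^n\ge0$. Let $g_{1-\alpha}(s)=s^{-\alpha}/\Gamma(1-\alpha)$ for $s>0$ and $E_\alpha(z)=\sum_{k\ge0}z^k/\Gamma(\alpha k+1)$. **Theorem.** There is a universal constant $\sigma>1$ (independent of $\alpha$,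 the grid, the scheme, $\lambda$, $c$, $\nu$, $\rho_1$ and the sequence) such that the following holds. Let the scheme be completely positive, let $\lambda>0$ and $c\in\mathbb R$, and let $(v_n)$ be a nonnegative sequence with $v_0>c/\lambda$. (1) Suppose that for some $\nu>0$ one has $c_{n-j}^n\ge\nu\,\frac1{\tau_j}\int_{t_{j-1}}^{t_j}g_{1-\alpha}(t_n-s)\,ds$ for all $1\le j\le n$. If $\mathcal D_\tau^\alpha v_n\ge-\lambda v_n+c$ for all $n\ge1$, then for all $n\ge0$ $$v_n\ge\Big(v_0-\frac c\lambda\Big)E_\alpha\big(-\nu^{-1}\lambda t_n^\alpha\big)+\frac c\lambda .$$ (2) Suppose that for some $\rho_1>0$ one has $c_{n-j}^n\le\rho_1\,\frac1{\tau_j}\int_{t_{j-1}}^{t_j}g_{1-\alpha}(t_n-s)\,ds$ for all $1\le j\le n$. If $\mathcal D_\tau^\alpha v_n\le-\lambda v_n+c$ for all $n\ge1$, then for all $n\ge0$ $$v_n\le\Big(v_0-\frac c\lambda\Big)E_\alpha\Big(-\frac{\lambda(1-\alpha)}{\rho_1}t_n^\alpha\Big)+\frac c\lambda .$$ If moreover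 $\lambda\tau_n^\alpha\le1$ for all $n\ge1$ and $\sigma\rho_1\ge1$ (in particular whenever $\rho_1\ge1$), then for all $n\ge0$ $$v_n\le\Big(v_0-\frac c\lambda\Big)E_\alpha\Big(-\frac{\lambda}{\sigma\rho_1}t_n^\alpha\Big)+\frac c\lambda .$$ -/

import Mathlib

open scoped BigOperators

noncomputable section

namespace FracGronwall

/-- The Abel kernel `g_β(s) = s^(β-1) / Γ(β)` for `s > 0`, extended by zero to `s ≤ 0`. -/
def abelKernel (β s : ℝ) : ℝ :=
  if 0 < s then s ^ (β - 1) / Real.Gamma β else 0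

/-- The two-parameter Mittag-Leffler function `E_{α,β}` at a real argument, by its power series
(which converges for every argument when `α > 0`). -/
def mittagLeffler₂ (α β z : ℝ) : ℝ :=
  ∑' k : ℕ, z ^ k / Real.Gamma (α * k + β)

/-- The Mittag-Leffler function `E_α = E_{α,1}`. -/
def mittagLeffler (α z : ℝ) : ℝ := mittagLeffler₂ α 1 z

/-- A grid `0 = t_0 < t_1 < ⋯` with points `t_n`, `n ≤ N`. The number `N` of steps is finite, or
`⊤` for infinitely many grid points; values of `t` beyond `N` are irrelevant. -/
structure IsGrid (N : ℕ∞) (t : ℕ → ℝ) : Prop where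
  zero : t 0 = 0
  lt : ∀ n : ℕ, 1 ≤ n → (n : ℕ∞) ≤ N → t (n - 1) < t n

/-- The step size `τ_n = t_n - t_{n-1}`, for `n ≥ 1`. -/
def step (t : ℕ → ℝ) (n : ℕ) : ℝ := t n - t (n - 1)

/-- A lower triangular array kernel: `K n k` is the entry `K_k^n`. Only the entries with
`n ≥ 1` and `0 ≤ k ≤ n - 1` are meaningful. -/
abbrev ArrayKernel : Type := ℕ → ℕ → ℝ

/-- Two array kernels have the same rows `1, …, N`. -/
def EqUpTo (N : ℕ∞) (K K' : ArrayKernel) : Prop :=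
  ∀ n k : ℕ, k < n → (n : ℕ∞) ≤ N → K n k = K' n k

/-- The pseudo-convolution `(A ∗ B)_k^n = ∑_{j=0}^k A_{k-j}^n B_j^{n+j-k}`, that is, the product
of lower triangular arrays. -/
def pconv (A B : ArrayKernel) : ArrayKernel :=
  fun n k => ∑ j ∈ Finset.range (k + 1), A n (k - j) * B (n + j - k) j

/-- The identity kernel `I_{n-j}^n = δ_{nj}`. -/
def idKernel : ArrayKernel := fun _ k => if k = 0 then 1 else 0

/-- The kernel `L` all of whose (lower triangular) entries are one. -/
def onesKernel : ArrayKernel := fun _ _ => 1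

/-- `B` is the inverse of `A` for the pseudo-convolution. -/
def IsInverse (N : ℕ∞) (A B : ArrayKernel) : Prop :=
  EqUpTo N (pconv A B) idKernel ∧ EqUpTo N (pconv B A) idKernel

/-- The array kernel `A` is completely positive: it is invertible, and its inverse `B` has positive
diagonal entries, nonpositive off-diagonal entries and nonnegative row sums. -/
def CompletelyPositive (N : ℕ∞) (A : ArrayKernel) : Prop :=
  ∃ B : ArrayKernel, IsInverse N A B ∧
    ∀ n : ℕ, 1 ≤ n → (n : ℕ∞) ≤ N →
      0 < B n 0 ∧
      (∀ j : ℕ, 1 ≤ j → j < n → B n (n - j) ≤ 0) ∧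
      0 ≤ ∑ j ∈ Finset.Icc 1 n, B n (n - j)

/-- `C` is the right complementary kernel of `A`, that is, `A ∗ C = L`. -/
def IsRightComplementary (N : ℕ∞) (A C : ArrayKernel) : Prop :=
  EqUpTo N (pconv A C) onesKernel

/-- The discretization of the fractional derivative with kernel `C` is completely positive: the
kernel `A` of the equivalent integral scheme, whose right complementary kernel is `C`, is
completely positive. -/
def CompletelyPositiveScheme (N : ℕ∞) (C : ArrayKernel) : Prop :=
  ∃ A : ArrayKernel, IsRightComplementary N A C ∧ CompletelyPositive N A

/-- The discrete fractional derivative `D_τ^α u_n = ∑_{j=1}^n C_{n-j}^n (u_j - u_{j-1})`. -/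
def discreteDeriv (C : ArrayKernel) (u : ℕ → ℝ) (n : ℕ) : ℝ :=
  ∑ j ∈ Finset.Icc 1 n, C n (n - j) * (u j - u (j - 1))

/-- The average of `s ↦ g_{1-α}(t_n - s)` over `[t_{j-1}, t_j]`. -/
def kernelAverage (α : ℝ) (t : ℕ → ℝ) (n j : ℕ) : ℝ :=
  1 / step t j * ∫ s in (t (j - 1))..(t j), abelKernel (1 - α) (t n - s)

/-- The lower kernel bound with constant `ν`. -/
def KernelLowerBound (α : ℝ) (N : ℕ∞) (t : ℕ → ℝ) (C : ArrayKernel) (ν : ℝ) : Prop :=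
  ∀ n j : ℕ, 1 ≤ j → j ≤ n → (n : ℕ∞) ≤ N → ν * kernelAverage α t n j ≤ C n (n - j)

/-- The upper kernel bound with constant `ρ₁`. -/
def KernelUpperBound (α : ℝ) (N : ℕ∞) (t : ℕ → ℝ) (C : ArrayKernel) (ρ₁ : ℝ) : Prop :=
  ∀ n j : ℕ, 1 ≤ j → j ≤ n → (n : ℕ∞) ≤ N → C n (n - j) ≤ ρ₁ * kernelAverage α t n j

end FracGronwall

end

/-! ### Monotone kernels and the discrete comparison principle. -/

namespace FracGronwall

open Finset

/-! The function `φ(t) = E_α(-μ t^α)` solves the continuous relaxation equation, and sampled on the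
grid it is a discrete sub- or supersolution for a suitable `μ`. A discrete comparison principle then
transfers the bound to `v`.

Comparison: if `B` is the inverse of `A`, then `A ∗ C = L` gives `C = B ∗ L`, so the entries of `C`
are partial row sums of `B`. The signs of `B` make each row of `C` nonnegative and monotone, with
positive diagonal, and summation by parts excludes a first negative value
(`IsMonotoneKernel.nonneg_of_le_discreteDeriv`).

Consistency: `φ' = -μ r` with `r(s) = s^(α-1) E_{α,α}(-μ s^α)`, and the integral of `g_{1-α}(t_n -
s) r(s)` over `[0, t_n]` is `φ(t_n)`. Hence `D φ_n` is `-μ` times the sum over `j` of `c_{n-j}^n`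
times the integral of `r` over the `j`-th cell. It remains to compare, cell by cell, (mean of
`g`)·`∫ r` with `∫ g r`. As `g(t_n - ·)` increases and `r` decreases, Chebyshev's inequality gives
`≥`, hence (1) with `μ = λ/ν`. For (2) a reverse inequality with a factor `K` is needed, and `μ =
λ/(ρ₁ K)`. The mean of `g` is at most `1/(1-α)` times its minimum, so `K = 1/(1-α)` always works.
When `μ τ^α ≤ 1` and `α ≥ 1/2`, a Harnack inequality for `E_{α,α}` bounds the mean of `r` by a
universal multiple of its minimum instead; for `α < 1/2`, `1/(1-α) ≤ 2`.

Positivity and monotonicity of `r` come from its Volterra equation (`mittagLeffler₂_neg_pos`) and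
the resolvent identity (`mittagLeffler₂_neg_anti`). -/

theorem pconv_assoc (A B C : ArrayKernel) {n k : ℕ} (hk : k < n) :
    pconv (pconv A B) C n k = pconv A (pconv B C) n k := by
  simp only [pconv, Finset.sum_mul, Finset.mul_sum]
  rw [Finset.sum_sigma', Finset.sum_sigma']
  refine Finset.sum_bij' (fun p _ => ⟨p.1 + p.2, p.1⟩) (fun p _ => ⟨p.2, p.1 - p.2⟩)
    ?_ ?_ ?_ ?_ ?_
  · rintro ⟨j, i⟩ h
    simp only [mem_sigma, mem_range] at h ⊢
    omega
  · rintro ⟨i, j⟩ h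
    simp only [mem_sigma, mem_range] at h ⊢
    omega
  · rintro ⟨j, i⟩ h
    simp
  · rintro ⟨i, j⟩ h
    simp only [mem_sigma, mem_range] at h
    have : j + (i - j) = i := by omega
    simp [this]
  · rintro ⟨j, i⟩ h
    simp only [mem_sigma, mem_range] at h
    have h1 : k - j - i = k - (j + i) := by omega
    have h2 : n + i - (k - j) = n + (j + i) - k := by omega
    have h3 : j + i - j = i := by omega
    have h4 : n + (j + i) - k + j - (j + i) = n + j - k := by omega
    simp only [h1, h2, h3, h4, mul_assoc]

theorem EqUpTo.pconv_right {N : ℕ∞} {A B B' : ArrayKernel} (h : EqUpTo N B B') :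
    EqUpTo N (pconv A B) (pconv A B') := by
  intro n k hk hn
  refine Finset.sum_congr rfl fun j hj => ?_
  rw [mem_range] at hj
  rw [h (n + j - k) j (by omega) (le_trans (by exact_mod_cast (by omega : n + j - k ≤ n)) hn)]

theorem EqUpTo.pconv_left {N : ℕ∞} {A A' B : ArrayKernel} (h : EqUpTo N A A') :
    EqUpTo N (pconv A B) (pconv A' B) := by
  intro n k hk hn
  refine Finset.sum_congr rfl fun j hj => ?_
  rw [h n (k - j) (by omega) hn]

theorem idKernel_pconv (C : ArrayKernel) (n k : ℕ) : pconv idKernel C n k = C n k := by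
  rw [pconv, Finset.sum_eq_single_of_mem k (by simp)]
  · simp [idKernel]
  · intro j hj hjk
    rw [mem_range] at hj
    simp [idKernel, show k - j ≠ 0 by omega]

/-- This turns the sign conditions on `B` into conditions on `C`: a sign of an entry of `B` is a
monotonicity of `C`, and the full row sum of `B` is the last entry of the row of `C`. -/
theorem eq_sum_of_isInverse {N : ℕ∞} {A B C : ArrayKernel} (hAC : IsRightComplementary N A C)
    (hAB : IsInverse N A B) {n k : ℕ} (hk : k < n) (hn : (n : ℕ∞) ≤ N) :
    C n k = ∑ i ∈ range (k + 1), B n i := by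
  calc C n k = pconv idKernel C n k := (idKernel_pconv C n k).symm
    _ = pconv (pconv B A) C n k := (hAB.2.pconv_left n k hk hn).symm
    _ = pconv B (pconv A C) n k := pconv_assoc B A C hk
    _ = pconv B onesKernel n k := EqUpTo.pconv_right hAC n k hk hn
    _ = ∑ i ∈ range (k + 1), B n i := by
      simp only [pconv, onesKernel, mul_one]
      rw [← Finset.sum_range_reflect]
      refine Finset.sum_congr rfl fun j hj => ?_
      rw [mem_range] at hj
      congr 1
      omega

/-- The rows of the kernel of a completely positive scheme are nonnegative and nonincreasing, with
positive diagonal entries. -/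
structure IsMonotoneKernel (N : ℕ∞) (C : ArrayKernel) : Prop where
  diag_pos : ∀ n : ℕ, 1 ≤ n → (n : ℕ∞) ≤ N → 0 < C n 0
  succ_le : ∀ n k : ℕ, k + 1 < n → (n : ℕ∞) ≤ N → C n (k + 1) ≤ C n k
  nonneg : ∀ n k : ℕ, k < n → (n : ℕ∞) ≤ N → 0 ≤ C n k

theorem CompletelyPositiveScheme.isMonotoneKernel {N : ℕ∞} {C : ArrayKernel}
    (h : CompletelyPositiveScheme N C) : IsMonotoneKernel N C := by
  obtain ⟨A, hAC, B, hAB, hB⟩ := h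
  have hC {n k : ℕ} (hk : k < n) (hn : (n : ℕ∞) ≤ N) := eq_sum_of_isInverse hAC hAB hk hn
  have hsucc : ∀ n k : ℕ, k + 1 < n → (n : ℕ∞) ≤ N → C n (k + 1) ≤ C n k := by
    intro n k hk hn
    rw [hC hk hn, hC (by omega) hn, Finset.sum_range_succ _ (k + 1)]
    have := (hB n (by omega) hn).2.1 (n - (k + 1)) (by omega) (by omega)
    rw [show n - (n - (k + 1)) = k + 1 by omega] at this
    linarith
  refine ⟨fun n hn hN => ?_, hsucc, fun n k hk hn => ?_⟩
  · rw [hC (by omega) hN]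
    simpa using (hB n hn hN).1
  · have hlast : 0 ≤ C n (n - 1) := by
      rw [hC (by omega) hn]
      refine (hB n (by omega) hn).2.2.trans_eq ?_
      refine Finset.sum_bij' (fun j _ => n - j) (fun i _ => n - i) ?_ ?_ ?_ ?_ ?_ <;>
        intro j hj <;> simp only [mem_Icc, mem_range] at hj ⊢ <;> omega
    have key : ∀ d, ∀ k, k + d + 1 = n → 0 ≤ C n k := by
      intro d
      induction d with
      | zero => intro k hk; rwa [show k = n - 1 by omega]
      | succ d ih => intro k hk; exact (ih (k + 1) (by omega)).trans (hsucc n k (by omega) hn)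
    exact key (n - 1 - k) k (by omega)

/-- Summation by parts: the discarded terms are `a 1 * w 0` and `(a (j + 1) - a j) * w j` with `j <
m`. No sign is required of `w m`. -/
theorem sum_mul_sub_le {a w : ℕ → ℝ} {m : ℕ} (hm : 1 ≤ m) (ha₁ : 0 ≤ a 1)
    (ha : ∀ j, 1 ≤ j → j < m → a j ≤ a (j + 1)) (hw : ∀ j < m, 0 ≤ w j) :
    ∑ j ∈ Icc 1 m, a j * (w j - w (j - 1)) ≤ a m * w m := by
  induction m, hm using Nat.le_induction with
  | base =>
    simp only [Icc_self, sum_singleton]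
    nlinarith [mul_nonneg ha₁ (hw 0 (by omega))]
  | succ m hm ih =>
    rw [Finset.sum_Icc_succ_top (by omega)]
    have h1 := ih (fun j h h' => ha j h (by omega)) (fun j h => hw j (by omega))
    have h2 := ha m hm (by omega)
    have h3 := hw m (by omega)
    simp only [Nat.add_sub_cancel]
    nlinarith [mul_nonneg (sub_nonneg.2 h2) h3]

/-- The comparison principle for the discrete fractional relaxation inequality. -/
theorem IsMonotoneKernel.nonneg_of_le_discreteDeriv {N : ℕ∞} {C : ArrayKernel}
    (hC : IsMonotoneKernel N C) {lam : ℝ} (hlam : 0 < lam) {w : ℕ → ℝ} (h0 : 0 ≤ w 0)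
    (hw : ∀ n : ℕ, 1 ≤ n → (n : ℕ∞) ≤ N → -lam * w n ≤ discreteDeriv C w n) (n : ℕ)
    (hn : (n : ℕ∞) ≤ N) : 0 ≤ w n := by
  induction n using Nat.strong_induction_on with
  | _ n ih =>
    rcases Nat.eq_zero_or_pos n with rfl | hpos
    · exact h0
    by_contra! hneg
    -- All earlier values are nonnegative, so `-λ w_n ≤ C n 0 * w_n`; with `w_n < 0` the left side
    -- is positive and the right side negative.
    have h1 : discreteDeriv C w n ≤ C n (n - n) * w n := by
      refine sum_mul_sub_le (a := fun j => C n (n - j)) hpos (hC.nonneg n _ (by omega) hn) ?_ ?_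
      · intro j hj hjn
        have := hC.succ_le n (n - (j + 1)) (by omega) hn
        rwa [show n - (j + 1) + 1 = n - j by omega] at this
      · intro j hj
        exact ih j hj (le_trans (by exact_mod_cast hj.le) hn)
    rw [Nat.sub_self] at h1
    have h2 := hw n hpos hn
    have h3 := hC.diag_pos n hpos hn
    nlinarith

theorem discreteDeriv_sub (C : ArrayKernel) (u w : ℕ → ℝ) (n : ℕ) :
    discreteDeriv C (fun k => u k - w k) n = discreteDeriv C u n - discreteDeriv C w n := by
  rw [discreteDeriv, discreteDeriv, discreteDeriv, ← Finset.sum_sub_distrib]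
  exact Finset.sum_congr rfl fun j _ => by ring

theorem discreteDeriv_add_const (C : ArrayKernel) (u : ℕ → ℝ) (d : ℝ) (n : ℕ) :
    discreteDeriv C (fun k => u k + d) n = discreteDeriv C u n := by
  simp [discreteDeriv]

theorem discreteDeriv_const_mul (C : ArrayKernel) (u : ℕ → ℝ) (d : ℝ) (n : ℕ) :
    discreteDeriv C (fun k => d * u k) n = d * discreteDeriv C u n := by
  rw [discreteDeriv, discreteDeriv, Finset.mul_sum]
  exact Finset.sum_congr rfl fun j _ => by ring

end FracGronwall

/-! ### Mittag-Leffler series and their convolutions. -/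

namespace FracGronwall

open Filter Topology MeasureTheory Set

/-- Log-convexity of `Γ` at `x`, as a convex combination of `x - 1` and `x + a`, together with `Γ(x)
= (x - 1) Γ(x - 1)`. It drives the ratio test below. -/
theorem Gamma_mul_rpow_le_Gamma_add {x a : ℝ} (hx : 1 < x) (ha : 0 < a) :
    Real.Gamma x * (x - 1) ^ a ≤ Real.Gamma (x + a) := by
  have hG : 0 < Real.Gamma x := Real.Gamma_pos_of_pos (by linarith)
  have hG' : 0 < Real.Gamma (x + a) := Real.Gamma_pos_of_pos (by linarith)
  have hx1 : 0 < x - 1 := by linarith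
  have h := Real.Gamma_mul_add_mul_le_rpow_Gamma_mul_rpow_Gamma (s := x - 1) (t := x + a)
    (a := a / (1 + a)) (b := 1 / (1 + a)) hx1 (by linarith) (by positivity) (by positivity)
    (by field_simp; ring)
  rw [show a / (1 + a) * (x - 1) + 1 / (1 + a) * (x + a) = x by field_simp; ring] at h
  have hrec : Real.Gamma x = (x - 1) * Real.Gamma (x - 1) := by
    simpa using Real.Gamma_add_one hx1.ne'
  have hG1 : Real.Gamma (x - 1) = Real.Gamma x / (x - 1) := by rw [hrec]; field_simp
  rw [hG1] at h
  have h2 := Real.rpow_le_rpow hG.le h (show (0 : ℝ) ≤ 1 + a by linarith)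
  rw [Real.mul_rpow (by positivity) (by positivity), ← Real.rpow_mul (by positivity),
    ← Real.rpow_mul hG'.le, div_mul_cancel₀ _ (by linarith), div_mul_cancel₀ _ (by linarith),
    Real.rpow_one, Real.rpow_add hG, Real.rpow_one, Real.div_rpow hG.le hx1.le] at h2
  have hpa : 0 < Real.Gamma x ^ a := Real.rpow_pos_of_pos hG a
  have hpx : 0 < (x - 1) ^ a := Real.rpow_pos_of_pos hx1 a
  rw [div_mul_eq_mul_div, le_div_iff₀ hpx] at h2
  refine le_of_mul_le_mul_left ?_ hpa
  linarith

theorem summable_mittagLeffler₂ {a : ℝ} (ha : 0 < a) (b z : ℝ) :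
    Summable fun k : ℕ => z ^ k / Real.Gamma (a * k + b) := by
  refine summable_of_ratio_norm_eventually_le (r := 1 / 2) (by norm_num) ?_
  have h1 : Tendsto (fun k : ℕ => a * (k : ℝ) + b) atTop atTop :=
    tendsto_atTop_add_const_right _ _ (tendsto_natCast_atTop_atTop.const_mul_atTop ha)
  have h2 : Tendsto (fun k : ℕ => (a * (k : ℝ) + b - 1) ^ a) atTop atTop :=
    (tendsto_rpow_atTop ha).comp (tendsto_atTop_add_const_right _ (-1) h1)
  filter_upwards [h1.eventually_gt_atTop 1, h2.eventually_ge_atTop (2 * |z|)] with k hk hk2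
  have hG : 0 < Real.Gamma (a * k + b) := Real.Gamma_pos_of_pos (by linarith)
  have h3 := Gamma_mul_rpow_le_Gamma_add hk ha
  rw [show a * ((k + 1 : ℕ) : ℝ) + b = a * k + b + a by push_cast; ring]
  have hG' : 0 < Real.Gamma (a * k + b + a) := Real.Gamma_pos_of_pos (by linarith)
  rw [norm_div, norm_div, norm_pow, norm_pow, Real.norm_eq_abs, Real.norm_of_nonneg hG.le,
    Real.norm_of_nonneg hG'.le, div_le_iff₀ hG', pow_succ]
  have h4 : Real.Gamma (a * k + b) * (2 * |z|) ≤ Real.Gamma (a * k + b + a) :=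
    (mul_le_mul_of_nonneg_left hk2 hG.le).trans h3
  calc |z| ^ k * |z| = 1 / 2 * (|z| ^ k / Real.Gamma (a * k + b)) *
        (Real.Gamma (a * k + b) * (2 * |z|)) := by field_simp
    _ ≤ _ := by gcongr

theorem hasSum_mittagLeffler₂ {a : ℝ} (ha : 0 < a) (b z : ℝ) :
    HasSum (fun k : ℕ => z ^ k / Real.Gamma (a * k + b)) (mittagLeffler₂ a b z) :=
  (summable_mittagLeffler₂ ha b z).hasSum

theorem continuous_mittagLeffler₂ {a b : ℝ} (ha : 0 < a) (hb : 0 < b) :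
    Continuous (mittagLeffler₂ a b) := by
  rw [continuous_iff_continuousAt]
  intro z
  have hopen : Icc (-(|z| + 1)) (|z| + 1) ∈ 𝓝 z :=
    Icc_mem_nhds (by linarith [neg_abs_le z]) (by linarith [le_abs_self z])
  refine ContinuousOn.continuousAt ?_ hopen
  refine continuousOn_tsum (fun k => by fun_prop) (summable_mittagLeffler₂ ha b (|z| + 1)) ?_
  intro k x hx
  have hG : 0 < Real.Gamma (a * k + b) := Real.Gamma_pos_of_pos (by positivity)
  rw [norm_div, norm_pow, Real.norm_eq_abs, Real.norm_of_nonneg hG.le]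
  have := abs_le.2 hx
  gcongr

theorem mittagLeffler₂_zero {a : ℝ} (ha : 0 < a) (b : ℝ) :
    mittagLeffler₂ a b 0 = 1 / Real.Gamma b := by
  refine (hasSum_mittagLeffler₂ ha b 0).unique ?_
  convert hasSum_single (f := fun k : ℕ => (0 : ℝ) ^ k / Real.Gamma (a * k + b)) 0 ?_ using 1
  · simp
  · intro k hk
    simp [hk]

theorem mittagLeffler₂_eq_add {a : ℝ} (ha : 0 < a) (b z : ℝ) :
    mittagLeffler₂ a b z = 1 / Real.Gamma b + z * mittagLeffler₂ a (a + b) z := by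
  have h := (summable_mittagLeffler₂ ha b z).tsum_eq_zero_add
  rw [mittagLeffler₂, h, mittagLeffler₂, ← tsum_mul_left]
  congr 1
  · simp
  · refine tsum_congr fun k => ?_
    rw [show a * ((k + 1 : ℕ) : ℝ) + b = a * k + (a + b) by push_cast; ring, pow_succ]
    ring

theorem intervalIntegrable_rpow_mul_sub_rpow {b c T : ℝ} (hb : 0 < b) (hc : 0 < c) (hT : 0 < T) :
    IntervalIntegrable (fun s => s ^ (b - 1) * (T - s) ^ (c - 1)) volume 0 T := by
  have key : ∀ b c : ℝ, 0 < b →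
      IntervalIntegrable (fun s => s ^ (b - 1) * (T - s) ^ (c - 1)) volume 0 (T / 2) := by
    intro b c hb
    refine (intervalIntegral.intervalIntegrable_rpow' (by linarith)).mul_continuousOn ?_
    refine ContinuousOn.rpow_const (by fun_prop) fun x hx => Or.inl ?_
    rw [uIcc_of_le (by linarith)] at hx
    linarith [hx.2]
  -- On each half only one factor is singular; reflecting `s ↦ T - s` reduces the right half to the
  -- left.
  refine (key b c hb).trans ?_
  have h := ((key c b hc).comp_sub_left T).symm
  rw [sub_zero, show T - T / 2 = T / 2 by ring] at h
  convert h using 2 with s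
  rw [mul_comm, sub_sub_cancel]

theorem integral_rpow_mul_sub_rpow {b c T : ℝ} (hb : 0 < b) (hc : 0 < c) (hT : 0 < T) :
    ∫ s in (0 : ℝ)..T, s ^ (b - 1) * (T - s) ^ (c - 1) =
      T ^ (b + c - 1) * (Real.Gamma b * Real.Gamma c / Real.Gamma (b + c)) := by
  have h := Complex.betaIntegral_scaled b c hT
  rw [Complex.betaIntegral_eq_Gamma_mul_div _ _ (by simpa) (by simpa)] at h
  have h2 : ∫ x in (0 : ℝ)..T, (x : ℂ) ^ ((b : ℂ) - 1) * ((T : ℂ) - x) ^ ((c : ℂ) - 1) =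
      ((∫ s in (0 : ℝ)..T, s ^ (b - 1) * (T - s) ^ (c - 1) : ℝ) : ℂ) := by
    rw [← intervalIntegral.integral_ofReal]
    refine intervalIntegral.integral_congr fun x hx => ?_
    rw [uIcc_of_le hT.le] at hx
    push_cast
    rw [Complex.ofReal_cpow hx.1, Complex.ofReal_cpow (sub_nonneg.2 hx.2)]
    push_cast
    rfl
  rw [h2] at h
  have h3 : (T : ℂ) ^ ((b : ℂ) + c - 1) = ((T ^ (b + c - 1) : ℝ) : ℂ) := by
    rw [Complex.ofReal_cpow hT.le]
    push_cast
    rfl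
  rw [h3, ← Complex.ofReal_add, Complex.Gamma_ofReal, Complex.Gamma_ofReal,
    Complex.Gamma_ofReal] at h
  exact_mod_cast h

/-- On the antidiagonal of index `m` there are `m + 1 ≤ 2 ^ m` terms, each at most `M ^ m * u m`;
the factor `2 ^ m` is harmless since the series of `u` converges everywhere. -/
theorem summable_prod_pow_mul {u : ℕ → ℝ} (hu : ∀ m, 0 ≤ u m)
    (hsum : ∀ z : ℝ, Summable fun m => z ^ m * u m) (x y : ℝ) (hx : 0 ≤ x) (hy : 0 ≤ y) :
    Summable fun p : ℕ × ℕ => x ^ p.1 * y ^ p.2 * u (p.1 + p.2) := by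
  rw [← Finset.HasAntidiagonal.sigmaAntidiagonalEquivProd.summable_iff,
    summable_sigma_of_nonneg (fun p => by
      have := hu ((Finset.HasAntidiagonal.sigmaAntidiagonalEquivProd p).1 +
        (Finset.HasAntidiagonal.sigmaAntidiagonalEquivProd p).2)
      simp only [Function.comp_apply]
      positivity)]
  refine ⟨fun m => (hasSum_fintype _).summable, ?_⟩
  set M := max x y with hM
  have hM0 : 0 ≤ M := hx.trans (le_max_left _ _)
  refine Summable.of_nonneg_of_le (fun m => tsum_nonneg fun p => ?_) (fun m => ?_) (hsum (2 * M))
  · have := hu ((Finset.HasAntidiagonal.sigmaAntidiagonalEquivProd ⟨m, p⟩).1 +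
        (Finset.HasAntidiagonal.sigmaAntidiagonalEquivProd ⟨m, p⟩).2)
    simp only [Function.comp_apply]
    positivity
  · rw [tsum_fintype]
    calc _ ≤ ∑ _p : Finset.HasAntidiagonal.antidiagonal m, M ^ m * u m := by
          refine Finset.sum_le_sum fun p _ => ?_
          have hp : p.1.1 + p.1.2 = m := Finset.HasAntidiagonal.mem_antidiagonal.1 p.2
          change x ^ p.1.1 * y ^ p.1.2 * u (p.1.1 + p.1.2) ≤ _
          rw [hp]
          refine mul_le_mul_of_nonneg_right ?_ (hu m)
          rw [← congrArg (M ^ ·) hp]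
          simp only [pow_add]
          gcongr
          · exact le_max_left _ _
          · exact le_max_right _ _
      _ = (m + 1) * (M ^ m * u m) := by simp
      _ ≤ 2 ^ m * (M ^ m * u m) := by
          refine mul_le_mul_of_nonneg_right ?_ (mul_nonneg (pow_nonneg hM0 m) (hu m))
          exact_mod_cast (Nat.lt_two_pow_self : m < 2 ^ m)
      _ = (2 * M) ^ m * u m := by rw [mul_pow]; ring

theorem hasSum_sum_antidiagonal {f : ℕ × ℕ → ℝ} {s : ℝ} (h : HasSum f s) :
    HasSum (fun m => ∑ p ∈ Finset.HasAntidiagonal.antidiagonal m, f p) s := by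
  rw [← Finset.HasAntidiagonal.sigmaAntidiagonalEquivProd.hasSum_iff] at h
  refine h.sigma fun m => ?_
  rw [← Finset.sum_coe_sort]
  exact hasSum_fintype _

/-- The convolution of two Mittag-Leffler type functions, as a power series. -/
theorem convolution_mittagLeffler₂ {a b c : ℝ} (ha : 0 < a) (hb : 0 < b) (hc : 0 < c) {T : ℝ}
    (hT : 0 < T) (x y : ℝ) :
    IntervalIntegrable (fun s => (s ^ (b - 1) * mittagLeffler₂ a b (x * s ^ a)) *
        ((T - s) ^ (c - 1) * mittagLeffler₂ a c (y * (T - s) ^ a))) volume 0 T ∧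
    HasSum (fun m : ℕ => (∑ p ∈ Finset.HasAntidiagonal.antidiagonal m, x ^ p.1 * y ^ p.2) *
        (T ^ (a * m + (b + c) - 1) / Real.Gamma (a * m + (b + c))))
      (∫ s in (0 : ℝ)..T, (s ^ (b - 1) * mittagLeffler₂ a b (x * s ^ a)) *
        ((T - s) ^ (c - 1) * mittagLeffler₂ a c (y * (T - s) ^ a))) := by
  have hcont1 : Continuous fun s : ℝ => mittagLeffler₂ a b (x * s ^ a) :=
    (continuous_mittagLeffler₂ ha hb).comp
      (continuous_const.mul (Real.continuous_rpow_const ha.le))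
  have hcont2 : Continuous fun s : ℝ => mittagLeffler₂ a c (y * (T - s) ^ a) :=
    (continuous_mittagLeffler₂ ha hc).comp
      (continuous_const.mul ((Real.continuous_rpow_const ha.le).comp (by fun_prop)))
  refine ⟨?_, ?_⟩
  · refine ((intervalIntegrable_rpow_mul_sub_rpow hb hc hT).mul_continuousOn
      (hcont1.mul hcont2).continuousOn).congr ?_
    exact fun s _ => by rw [Pi.mul_apply]; ring
  set u : ℕ → ℝ := fun m => T ^ (a * m + (b + c) - 1) / Real.Gamma (a * m + (b + c)) with hu
  have hu0 : ∀ m, 0 ≤ u m := fun m =>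
    div_nonneg (by positivity) (Real.Gamma_pos_of_pos (by positivity)).le
  have husum : ∀ z : ℝ, Summable fun m => z ^ m * u m := by
    intro z
    refine ((summable_mittagLeffler₂ ha (b + c) (z * T ^ a)).mul_left (T ^ (b + c - 1))).congr ?_
    intro m
    change _ = z ^ m * (T ^ (a * m + (b + c) - 1) / Real.Gamma (a * m + (b + c)))
    rw [mul_pow, ← Real.rpow_mul_natCast hT.le,
      show a * m + (b + c) - 1 = (b + c - 1) + a * m by ring, Real.rpow_add hT]
    ring
  set F : ℕ × ℕ → ℝ → ℝ := fun p s =>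
    x ^ p.1 * y ^ p.2 / (Real.Gamma (a * p.1 + b) * Real.Gamma (a * p.2 + c)) *
      (s ^ (a * p.1 + b - 1) * (T - s) ^ (a * p.2 + c - 1)) with hF
  have hFint : ∀ p, IntervalIntegrable (F p) volume 0 T := fun p =>
    (intervalIntegrable_rpow_mul_sub_rpow (by positivity) (by positivity) hT).const_mul _
  have hGpos : ∀ {d : ℝ} (k : ℕ), 0 < d → 0 < Real.Gamma (a * k + d) := fun k hd =>
    Real.Gamma_pos_of_pos (by positivity)
  have hbeta : ∀ p : ℕ × ℕ, ∫ s in (0 : ℝ)..T,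
      (s ^ (a * p.1 + b - 1) * (T - s) ^ (a * p.2 + c - 1)) =
      Real.Gamma (a * p.1 + b) * Real.Gamma (a * p.2 + c) * u (p.1 + p.2) := by
    intro p
    rw [integral_rpow_mul_sub_rpow (by positivity) (by positivity) hT]
    rw [hu]
    push_cast
    rw [show a * p.1 + b + (a * p.2 + c) = a * (p.1 + p.2) + (b + c) by ring]
    ring
  have hFval : ∀ p, ∫ s in (0 : ℝ)..T, F p s = x ^ p.1 * y ^ p.2 * u (p.1 + p.2) := by
    intro p
    rw [hF, intervalIntegral.integral_const_mul, hbeta]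
    have h1 := (hGpos p.1 hb).ne'
    have h2 := (hGpos p.2 hc).ne'
    field_simp
  have hFnorm : ∀ p, ∫ s in Ioo 0 T, ‖F p s‖ = |x| ^ p.1 * |y| ^ p.2 * u (p.1 + p.2) := by
    intro p
    have h1 := (hGpos p.1 hb)
    have h2 := (hGpos p.2 hc)
    have : ∀ s ∈ Ioo 0 T, ‖F p s‖ =
        |x| ^ p.1 * |y| ^ p.2 / (Real.Gamma (a * p.1 + b) * Real.Gamma (a * p.2 + c)) *
          (s ^ (a * p.1 + b - 1) * (T - s) ^ (a * p.2 + c - 1)) := by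
      intro s hs
      have h3 : 0 ≤ s ^ (a * p.1 + b - 1) * (T - s) ^ (a * p.2 + c - 1) :=
        mul_nonneg (Real.rpow_nonneg hs.1.le _) (Real.rpow_nonneg (sub_nonneg.2 hs.2.le) _)
      rw [hF, norm_mul, norm_div, norm_mul, norm_pow, norm_pow, Real.norm_of_nonneg h3,
        Real.norm_of_nonneg (mul_pos h1 h2).le, Real.norm_eq_abs, Real.norm_eq_abs]
    rw [setIntegral_congr_fun measurableSet_Ioo this, ← integral_Ioc_eq_integral_Ioo,
      ← intervalIntegral.integral_of_le hT.le, intervalIntegral.integral_const_mul, hbeta]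
    field_simp
  -- Termwise integration: each Beta integral depends on `p` through `p.1 + p.2` after the Gamma
  -- factors cancel, and the integrals of the norms form the same double series at `|x|`, `|y|`.
  have hmain := hasSum_integral_of_summable_integral_norm (μ := volume.restrict (Ioo 0 T))
    (F := F) (fun p => (hFint p).1.mono_set Ioo_subset_Ioc_self) (by
      simp_rw [hFnorm]
      exact summable_prod_pow_mul hu0 husum _ _ (abs_nonneg x) (abs_nonneg y))
  have hpt : ∀ s ∈ Ioo 0 T, ∑' p, F p s = (s ^ (b - 1) * mittagLeffler₂ a b (x * s ^ a)) *
        ((T - s) ^ (c - 1) * mittagLeffler₂ a c (y * (T - s) ^ a)) := by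
    intro s hs
    have hs' : 0 < T - s := sub_pos.2 hs.2
    have h1 := (hasSum_mittagLeffler₂ ha b (x * s ^ a)).mul_left (s ^ (b - 1))
    have h2 := (hasSum_mittagLeffler₂ ha c (y * (T - s) ^ a)).mul_left ((T - s) ^ (c - 1))
    have h3 := h1.mul h2 (summable_mul_of_summable_norm h1.summable.norm h2.summable.norm)
    refine HasSum.tsum_eq ?_
    refine (congrArg (HasSum · _) (funext fun p => ?_)).mp h3
    rw [hF]
    beta_reduce
    rw [mul_pow, mul_pow, ← Real.rpow_mul_natCast hs.1.le, ← Real.rpow_mul_natCast hs'.le,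
      show a * p.1 + b - 1 = (b - 1) + a * p.1 by ring,
      show a * p.2 + c - 1 = (c - 1) + a * p.2 by ring, Real.rpow_add hs.1, Real.rpow_add hs']
    ring
  rw [setIntegral_congr_fun measurableSet_Ioo hpt, ← integral_Ioc_eq_integral_Ioo,
      ← intervalIntegral.integral_of_le hT.le] at hmain
  simp_rw [← integral_Ioc_eq_integral_Ioo, ← intervalIntegral.integral_of_le hT.le, hFval] at hmain
  convert hasSum_sum_antidiagonal hmain using 2 with m
  rw [Finset.sum_mul]
  refine Finset.sum_congr rfl fun p hp => ?_
  rw [Finset.HasAntidiagonal.mem_antidiagonal.1 hp]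

end FracGronwall

/-! ### The resolvent of the Abel kernel: Volterra equation, positivity, monotonicity. -/

namespace FracGronwall

open Filter Topology MeasureTheory Set

/-- The fractional integral of a Mittag-Leffler type function. -/
theorem integral_mittagLeffler₂_mul_sub_rpow {a b c : ℝ} (ha : 0 < a) (hb : 0 < b) (hc : 0 < c)
    {T : ℝ} (hT : 0 < T) (x : ℝ) :
    IntervalIntegrable (fun s => s ^ (b - 1) * mittagLeffler₂ a b (x * s ^ a) * (T - s) ^ (c - 1))
      volume 0 T ∧
    ∫ s in (0 : ℝ)..T, s ^ (b - 1) * mittagLeffler₂ a b (x * s ^ a) * (T - s) ^ (c - 1) =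
      Real.Gamma c * (T ^ (b + c - 1) * mittagLeffler₂ a (b + c) (x * T ^ a)) := by
  have hG := (Real.Gamma_pos_of_pos hc).ne'
  -- At `y = 0` the second Mittag-Leffler factor is the constant `1 / Γ(c)`.
  obtain ⟨h1, h2⟩ := convolution_mittagLeffler₂ ha hb hc hT x 0
  simp only [zero_mul, mittagLeffler₂_zero ha c, ← mul_assoc] at h1 h2
  constructor
  · refine (h1.mul_const (Real.Gamma c)).congr fun s _ => ?_
    field_simp
  rw [intervalIntegral.integral_mul_const] at h2
  have h3 := (hasSum_mittagLeffler₂ ha (b + c) (x * T ^ a)).mul_left (T ^ (b + c - 1))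
  have h4 : (fun m : ℕ => (∑ p ∈ Finset.HasAntidiagonal.antidiagonal m, x ^ p.1 * 0 ^ p.2) *
      (T ^ (a * m + (b + c) - 1) / Real.Gamma (a * m + (b + c)))) =
      fun m : ℕ => T ^ (b + c - 1) * ((x * T ^ a) ^ m / Real.Gamma (a * m + (b + c))) := by
    funext m
    rw [Finset.sum_eq_single_of_mem (m, 0) (by simp), mul_pow, ← Real.rpow_mul_natCast hT.le,
      show a * m + (b + c) - 1 = (b + c - 1) + a * m by ring, Real.rpow_add hT]
    · simp only [pow_zero]
      ring
    · rintro ⟨i, j⟩ hp hne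
      have hij := Finset.HasAntidiagonal.mem_antidiagonal.1 hp
      have : j ≠ 0 := by
        rintro rfl
        exact hne (by simpa using hij)
      simp [this]
  rw [h4] at h2
  rw [h3.unique h2]
  field_simp

/-- The resolvent identity for the kernels `s ^ (a - 1) * E_{a,a}(x * s ^ a)`, at time one. -/
theorem sub_mul_integral_mittagLeffler₂ {a : ℝ} (ha : 0 < a) (x y : ℝ) :
    (x - y) * ∫ s in (0 : ℝ)..1, (s ^ (a - 1) * mittagLeffler₂ a a (x * s ^ a)) *
        ((1 - s) ^ (a - 1) * mittagLeffler₂ a a (y * (1 - s) ^ a)) =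
      mittagLeffler₂ a a x - mittagLeffler₂ a a y := by
  have h := (convolution_mittagLeffler₂ ha ha ha one_pos x y).2.mul_left (x - y)
  have hx := (hasSum_mittagLeffler₂ ha (a + a) x).mul_left x
  have hy := (hasSum_mittagLeffler₂ ha (a + a) y).mul_left y
  rw [mittagLeffler₂_eq_add ha a x, mittagLeffler₂_eq_add ha a y, add_sub_add_left_eq_sub]
  refine h.unique ?_
  refine (congrArg (HasSum · _) (funext fun m => ?_)).mp (hx.sub hy)
  have hg := geom_sum₂_mul x y (m + 1)
  have hanti : ∑ p ∈ Finset.HasAntidiagonal.antidiagonal m, x ^ p.1 * y ^ p.2 =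
      ∑ i ∈ Finset.range (m + 1), x ^ i * y ^ (m + 1 - 1 - i) :=
    Finset.Nat.sum_antidiagonal_eq_sum_range_succ (fun i j => x ^ i * y ^ j) m
  rw [hanti, Real.one_rpow, ← mul_assoc, mul_comm (x - y), hg]
  ring

/-- The resolvent of the Abel kernel, `s ^ (a - 1) * E_{a,a}(-μ * s ^ a)`. -/
noncomputable def abelResolvent (a μ s : ℝ) : ℝ := s ^ (a - 1) * mittagLeffler₂ a a (-μ * s ^ a)

theorem continuous_mittagLeffler₂_rpow {a b : ℝ} (ha : 0 < a) (hb : 0 < b) (x : ℝ) :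
    Continuous fun s : ℝ => mittagLeffler₂ a b (x * s ^ a) :=
  (continuous_mittagLeffler₂ ha hb).comp
    (continuous_const.mul (Real.continuous_rpow_const ha.le))

theorem intervalIntegrable_abelResolvent {a : ℝ} (ha : 0 < a) (μ x y : ℝ) :
    IntervalIntegrable (abelResolvent a μ) volume x y :=
  (intervalIntegral.intervalIntegrable_rpow' (by linarith)).mul_continuousOn
    (continuous_mittagLeffler₂_rpow ha ha (-μ)).continuousOn

/-- The Volterra equation of the resolvent. -/
theorem abelResolvent_eq {a : ℝ} (ha : 0 < a) (μ : ℝ) {T : ℝ} (hT : 0 < T) :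
    abelResolvent a μ T = T ^ (a - 1) / Real.Gamma a -
      μ / Real.Gamma a * ∫ s in (0 : ℝ)..T, abelResolvent a μ s * (T - s) ^ (a - 1) := by
  have hG := (Real.Gamma_pos_of_pos ha).ne'
  simp only [abelResolvent]
  rw [(integral_mittagLeffler₂_mul_sub_rpow ha ha ha hT (-μ)).2, mittagLeffler₂_eq_add ha a,
    show a + a - 1 = (a - 1) + a by ring, Real.rpow_add hT]
  field_simp
  ring

theorem intervalIntegrable_abelResolvent_mul {a : ℝ} (ha : 0 < a) (μ : ℝ) {T : ℝ} (hT : 0 < T) :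
    IntervalIntegrable (fun s => abelResolvent a μ s * (T - s) ^ (a - 1)) volume 0 T :=
  (integral_mittagLeffler₂_mul_sub_rpow ha ha ha hT (-μ)).1

/-- A lower bound for the resolvent in terms of its earlier values, from the log-convexity of the
Abel kernel. -/
theorem sub_le_mittagLeffler₂_rpow {a μ : ℝ} (ha : 0 < a) (ha1 : a < 1) (hμ : 0 ≤ μ) {t T M : ℝ}
    (ht : 0 < t) (htT : t < T) (hpos : ∀ s ∈ Ico 0 T, 0 ≤ mittagLeffler₂ a a (-μ * s ^ a))
    (hM : ∀ s ∈ Ico t T, mittagLeffler₂ a a (-μ * s ^ a) ≤ M) :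
    mittagLeffler₂ a a (-μ * t ^ a) -
        M * ((T / t) ^ (1 - a) * (μ * (T - t) ^ a) / Real.Gamma (a + 1)) ≤
      mittagLeffler₂ a a (-μ * T ^ a) := by
  have hT : 0 < T := ht.trans htT
  have hG : 0 < Real.Gamma a := Real.Gamma_pos_of_pos ha
  have hM0 : 0 ≤ M := (hpos t ⟨ht.le, htT⟩).trans (hM t ⟨le_rfl, htT⟩)
  have hintT := intervalIntegrable_abelResolvent_mul ha μ hT
  have hint1 : IntervalIntegrable (fun s => abelResolvent a μ s * (T - s) ^ (a - 1)) volume 0 t :=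
    hintT.mono_set (by rw [uIcc_of_le ht.le, uIcc_of_le hT.le]; exact Icc_subset_Icc_right htT.le)
  have hint2 : IntervalIntegrable (fun s => abelResolvent a μ s * (T - s) ^ (a - 1)) volume t T :=
    hintT.mono_set (by rw [uIcc_of_le htT.le, uIcc_of_le hT.le]; exact Icc_subset_Icc_left ht.le)
  -- For `0 < s < t`, `T - s ≥ (T / t) (t - s)`, and the exponent `a - 1` is negative. The factor
  -- `(T / t) ^ (a - 1)` also relates `t ^ (a - 1)` to `T ^ (a - 1)`, so the history up to `t` can
  -- be eliminated by the Volterra equation at `t`.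
  have hI1 : ∫ s in (0 : ℝ)..t, abelResolvent a μ s * (T - s) ^ (a - 1) ≤
      (T / t) ^ (a - 1) * ∫ s in (0 : ℝ)..t, abelResolvent a μ s * (t - s) ^ (a - 1) := by
    rw [← intervalIntegral.integral_const_mul]
    refine intervalIntegral.integral_mono_on_of_le_Ioo ht.le hint1
      ((intervalIntegrable_abelResolvent_mul ha μ ht).const_mul _) fun s hs => ?_
    have hs1 : 0 < t - s := sub_pos.2 hs.2
    have h1 : T / t * (t - s) ≤ T - s := by
      rw [div_mul_eq_mul_div, div_le_iff₀ ht]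
      nlinarith [hs.1]
    have h2 := Real.rpow_le_rpow_of_nonpos (mul_pos (div_pos hT ht) hs1) h1
      (show a - 1 ≤ 0 by linarith)
    rw [Real.mul_rpow (by positivity) hs1.le] at h2
    have h3 : 0 ≤ abelResolvent a μ s :=
      mul_nonneg (Real.rpow_nonneg hs.1.le _) (hpos s ⟨hs.1.le, hs.2.trans htT⟩)
    calc _ ≤ abelResolvent a μ s * ((T / t) ^ (a - 1) * (t - s) ^ (a - 1)) := by gcongr
      _ = _ := by ring
  have hpow : IntervalIntegrable (fun s => (T - s) ^ (a - 1)) volume t T := by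
    have := ((intervalIntegral.intervalIntegrable_rpow' (a := 0) (b := T - t)
      (show -1 < a - 1 by linarith)).comp_sub_left T).symm
    simpa using this
  have hpowval : ∫ s in t..T, (T - s) ^ (a - 1) = (T - t) ^ a / a := by
    rw [intervalIntegral.integral_comp_sub_left (fun s => s ^ (a - 1)) T,
      integral_rpow (Or.inl (by linarith))]
    simp [Real.zero_rpow ha.ne']
  have hI2 : ∫ s in t..T, abelResolvent a μ s * (T - s) ^ (a - 1) ≤
      t ^ (a - 1) * M * ((T - t) ^ a / a) := by
    rw [← hpowval, ← intervalIntegral.integral_const_mul]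
    refine intervalIntegral.integral_mono_on_of_le_Ioo htT.le hint2
      (hpow.const_mul _) fun s hs => ?_
    refine mul_le_mul_of_nonneg_right ?_ (Real.rpow_nonneg (sub_nonneg.2 hs.2.le) _)
    exact mul_le_mul (Real.rpow_le_rpow_of_nonpos ht hs.1.le (by linarith))
      (hM s ⟨hs.1.le, hs.2⟩) (hpos s ⟨ht.le.trans hs.1.le, hs.2⟩) (Real.rpow_nonneg ht.le _)
  have eT := abelResolvent_eq ha μ hT
  have et := abelResolvent_eq ha μ ht
  rw [← intervalIntegral.integral_add_adjacent_intervals hint1 hint2] at eT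
  set J := ∫ s in (0 : ℝ)..t, abelResolvent a μ s * (t - s) ^ (a - 1)
  set I1 := ∫ s in (0 : ℝ)..t, abelResolvent a μ s * (T - s) ^ (a - 1)
  set I2 := ∫ s in t..T, abelResolvent a μ s * (T - s) ^ (a - 1)
  have hTp : 0 < T ^ (a - 1) := Real.rpow_pos_of_pos hT _
  have htp : 0 < t ^ (a - 1) := Real.rpow_pos_of_pos ht _
  have hratio : (T / t) ^ (a - 1) * t ^ (a - 1) = T ^ (a - 1) := by
    rw [← Real.mul_rpow (by positivity) ht.le, div_mul_cancel₀ _ ht.ne']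
  have hratio' : T ^ (a - 1) * (T / t) ^ (1 - a) = t ^ (a - 1) := by
    rw [← hratio, show (1 - a) = -(a - 1) by ring, Real.rpow_neg (by positivity)]
    have : (T / t) ^ (a - 1) ≠ 0 := by positivity
    field_simp
  simp only [abelResolvent] at eT et
  rw [Real.Gamma_add_one ha.ne']
  refine le_of_mul_le_mul_left ?_ hTp
  have hsum : I1 + I2 ≤ (T / t) ^ (a - 1) * J + t ^ (a - 1) * M * ((T - t) ^ a / a) :=
    add_le_add hI1 hI2
  have hmul := mul_le_mul_of_nonneg_left hsum (div_nonneg hμ hG.le)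
  have et' : μ / Real.Gamma a * J =
      t ^ (a - 1) / Real.Gamma a - t ^ (a - 1) * mittagLeffler₂ a a (-μ * t ^ a) := by
    linarith
  have h5 : μ / Real.Gamma a * ((T / t) ^ (a - 1) * J) =
      T ^ (a - 1) / Real.Gamma a - T ^ (a - 1) * mittagLeffler₂ a a (-μ * t ^ a) := by
    rw [← hratio]
    linear_combination (T / t) ^ (a - 1) * et'
  rw [mul_add _ ((T / t) ^ (a - 1) * J), h5] at hmul
  have h6 : T ^ (a - 1) * (mittagLeffler₂ a a (-μ * t ^ a) -
      M * ((T / t) ^ (1 - a) * (μ * (T - t) ^ a) / (a * Real.Gamma a))) =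
      T ^ (a - 1) * mittagLeffler₂ a a (-μ * t ^ a) -
      μ / Real.Gamma a * (t ^ (a - 1) * M * ((T - t) ^ a / a)) := by
    rw [← hratio']
    field_simp
  rw [h6, eT]
  linarith

/-- At a first zero `T` of `H(s) = E_{a,a}(-s^a)`, the lower bound by earlier values forces `H T >
0` once `t` is close to `T`. Taking `μ = 1` loses nothing, since `s ^ a` covers `[0, ∞)`. -/
theorem mittagLeffler₂_neg_pos {a : ℝ} (ha : 0 < a) (ha1 : a < 1) {x : ℝ} (hx : 0 ≤ x) :
    0 < mittagLeffler₂ a a (-x) := by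
  by_contra! hneg
  set H : ℝ → ℝ := fun s => mittagLeffler₂ a a (-1 * s ^ a) with hH
  have hcont : Continuous H := continuous_mittagLeffler₂_rpow ha ha (-1)
  set S : Set ℝ := {t | 0 ≤ t ∧ H t ≤ 0} with hS
  have hSclosed : IsClosed S := isClosed_Ici.inter (isClosed_le hcont continuous_const)
  have hSne : S.Nonempty := by
    refine ⟨x ^ a⁻¹, Real.rpow_nonneg hx _, ?_⟩
    rw [hH]
    beta_reduce
    rw [Real.rpow_inv_rpow hx ha.ne']
    simpa using hneg
  have hSbdd : BddBelow S := ⟨0, fun t ht => ht.1⟩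
  obtain ⟨hT0, hTle⟩ := hSclosed.csInf_mem hSne hSbdd
  set T := sInf S
  have hlt : ∀ t, 0 ≤ t → t < T → 0 < H t := by
    intro t ht htT
    by_contra! h
    exact absurd (csInf_le hSbdd ⟨ht, h⟩) (not_le.2 htT)
  have hT : 0 < T := by
    refine lt_of_le_of_ne hT0 fun h => ?_
    rw [← h, hH] at hTle
    simp only [Real.zero_rpow ha.ne', mul_zero, mittagLeffler₂_zero ha] at hTle
    have := Real.Gamma_pos_of_pos ha
    exact absurd hTle (not_le.2 (by positivity))
  have hΓ : 0 < Real.Gamma (a + 1) := Real.Gamma_pos_of_pos (by linarith)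
  have hev : ∀ᶠ t in 𝓝 T, (T / t) ^ (1 - a) * (1 * (T - t) ^ a) / Real.Gamma (a + 1) < 1 := by
    have hc : ContinuousAt
        (fun t : ℝ => (T / t) ^ (1 - a) * (1 * (T - t) ^ a) / Real.Gamma (a + 1)) T := by
      refine ContinuousAt.div_const (ContinuousAt.mul ?_ (ContinuousAt.mul continuousAt_const ?_)) _
      · exact (continuousAt_const.div continuousAt_id hT.ne').rpow_const (Or.inr (by linarith))
      · exact (continuousAt_const.sub continuousAt_id).rpow_const (Or.inr ha.le)
    refine hc.eventually_lt_const ?_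
    simp [Real.zero_rpow ha.ne']
  have hev2 : {t | 0 < t ∧
      (T / t) ^ (1 - a) * (1 * (T - t) ^ a) / Real.Gamma (a + 1) < 1} ∈ 𝓝[<] T :=
    mem_nhdsWithin_of_mem_nhds ((eventually_gt_nhds hT).and hev)
  obtain ⟨t₀, ht₀T, ht₀⟩ := mem_nhdsLT_iff_exists_Ico_subset.1 hev2
  have ht₀pos := (ht₀ ⟨le_rfl, ht₀T⟩).1
  -- Monotonicity of `H` is not yet known; choosing `t` as a maximum point allows `M = H t`.
  obtain ⟨t, htmem, htmax⟩ := isCompact_Icc.exists_isMaxOn (nonempty_Icc.2 ht₀T.le)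
    (hcont.continuousOn (s := Icc t₀ T))
  have hHt : 0 < H t :=
    (hlt t₀ ht₀pos.le ht₀T).trans_le (htmax (left_mem_Icc.2 ht₀T.le))
  have htT : t < T := by
    refine lt_of_le_of_ne htmem.2 ?_
    rintro rfl
    exact absurd hTle (not_le.2 hHt)
  obtain ⟨htpos, hsmall⟩ := ht₀ ⟨htmem.1, htT⟩
  have key := sub_le_mittagLeffler₂_rpow ha ha1 zero_le_one htpos htT
    (fun s hs => (hlt s hs.1 hs.2).le) (M := H t)
    (fun s hs => htmax ⟨htmem.1.trans hs.1, hs.2.le⟩)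
  have : H t - H t * ((T / t) ^ (1 - a) * (1 * (T - t) ^ a) / Real.Gamma (a + 1)) ≤ H T := key
  nlinarith [mul_pos hHt (sub_pos.2 hsmall)]

/-- By the resolvent identity the difference is `y - x` times an integral of a product of
resolvents, which are nonnegative. -/
theorem mittagLeffler₂_neg_anti {a : ℝ} (ha : 0 < a) (ha1 : a < 1) {x y : ℝ} (hx : 0 ≤ x)
    (hxy : x ≤ y) : mittagLeffler₂ a a (-y) ≤ mittagLeffler₂ a a (-x) := by
  have h := sub_mul_integral_mittagLeffler₂ ha (-x) (-y)
  have hI : 0 ≤ ∫ s in (0 : ℝ)..1, (s ^ (a - 1) * mittagLeffler₂ a a (-x * s ^ a)) *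
        ((1 - s) ^ (a - 1) * mittagLeffler₂ a a (-y * (1 - s) ^ a)) := by
    refine intervalIntegral.integral_nonneg zero_le_one fun s hs => ?_
    have h0 : 0 ≤ s := hs.1
    have h1 : 0 ≤ 1 - s := sub_nonneg.2 hs.2
    have hy : 0 ≤ y := hx.trans hxy
    rw [neg_mul, neg_mul]
    have h2 := mittagLeffler₂_neg_pos ha ha1 (mul_nonneg hx (Real.rpow_nonneg h0 a))
    have h3 := mittagLeffler₂_neg_pos ha ha1 (mul_nonneg hy (Real.rpow_nonneg h1 a))
    positivity
  nlinarith

theorem mittagLeffler₂_rpow_pos {a μ : ℝ} (ha : 0 < a) (ha1 : a < 1) (hμ : 0 ≤ μ) {s : ℝ}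
    (hs : 0 ≤ s) : 0 < mittagLeffler₂ a a (-μ * s ^ a) := by
  rw [neg_mul]
  exact mittagLeffler₂_neg_pos ha ha1 (by positivity)

theorem mittagLeffler₂_rpow_anti {a μ : ℝ} (ha : 0 < a) (ha1 : a < 1) (hμ : 0 ≤ μ) {s t : ℝ}
    (hs : 0 ≤ s) (hst : s ≤ t) :
    mittagLeffler₂ a a (-μ * t ^ a) ≤ mittagLeffler₂ a a (-μ * s ^ a) := by
  rw [neg_mul, neg_mul]
  exact mittagLeffler₂_neg_anti ha ha1 (by positivity) (by gcongr)

theorem abelResolvent_nonneg {a μ : ℝ} (ha : 0 < a) (ha1 : a < 1) (hμ : 0 ≤ μ) {s : ℝ}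
    (hs : 0 ≤ s) : 0 ≤ abelResolvent a μ s :=
  mul_nonneg (Real.rpow_nonneg hs _) (mittagLeffler₂_rpow_pos ha ha1 hμ hs).le

theorem abelResolvent_anti {a μ : ℝ} (ha : 0 < a) (ha1 : a < 1) (hμ : 0 ≤ μ) {s t : ℝ}
    (hs : 0 < s) (hst : s ≤ t) : abelResolvent a μ t ≤ abelResolvent a μ s :=
  mul_le_mul (Real.rpow_le_rpow_of_nonpos hs hst (by linarith))
    (mittagLeffler₂_rpow_anti ha ha1 hμ hs.le hst)
    (mittagLeffler₂_rpow_pos ha ha1 hμ (hs.le.trans hst)).le (Real.rpow_nonneg hs.le _)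

/-! ### Gamma bounds and a Harnack inequality for the resolvent. -/

theorem half_le_Gamma {x : ℝ} (h1 : 1 ≤ x) (h2 : x ≤ 2) : 1 / 2 ≤ Real.Gamma x := by
  have h := Real.Gamma_strictMonoOn_Ici.monotoneOn (a := 2) (b := x + 1) (by simp)
    (by simp; linarith) (by linarith)
  rw [Real.Gamma_two, Real.Gamma_add_one (by linarith)] at h
  have := Real.Gamma_pos_of_pos (show 0 < x by linarith)
  nlinarith

theorem Gamma_le_one {x : ℝ} (h1 : 1 ≤ x) (h2 : x ≤ 2) : Real.Gamma x ≤ 1 := by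
  have := Real.convexOn_Gamma.le_max_of_mem_Icc (x := 1) (y := 2) (z := x) (by simp) (by simp)
    ⟨h1, h2⟩
  simpa using this

theorem one_le_Gamma {x : ℝ} (h0 : 0 < x) (h1 : x ≤ 1) : 1 ≤ Real.Gamma x := by
  have := Real.Gamma_strictAntiOn_Ioc.antitoneOn (a := x) (b := 1) ⟨h0, h1⟩ (by simp) h1
  simpa using this

/-- A lower bound for the resolvent near zero. -/
theorem sub_le_mittagLeffler₂_rpow_zero {a μ : ℝ} (ha : 0 < a) (ha1 : a < 1) (hμ : 0 ≤ μ) {T : ℝ}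
    (hT : 0 < T) :
    1 / Real.Gamma a - μ * T ^ a / Real.Gamma (a + a) ≤ mittagLeffler₂ a a (-μ * T ^ a) := by
  have hG : 0 < Real.Gamma a := Real.Gamma_pos_of_pos ha
  have hI : ∫ s in (0 : ℝ)..T, abelResolvent a μ s * (T - s) ^ (a - 1) ≤
      1 / Real.Gamma a * ∫ s in (0 : ℝ)..T, s ^ (a - 1) * (T - s) ^ (a - 1) := by
    rw [← intervalIntegral.integral_const_mul]
    refine intervalIntegral.integral_mono_on_of_le_Ioo hT.le
      (intervalIntegrable_abelResolvent_mul ha μ hT)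
      ((intervalIntegrable_rpow_mul_sub_rpow ha ha hT).const_mul _) fun s hs => ?_
    have h1 := mittagLeffler₂_rpow_anti ha ha1 hμ le_rfl hs.1.le
    rw [Real.zero_rpow ha.ne', mul_zero, mittagLeffler₂_zero ha] at h1
    rw [abelResolvent, mul_comm (s ^ (a - 1)), mul_assoc]
    have h2 : 0 ≤ s := hs.1.le
    have h3 : 0 ≤ T - s := sub_nonneg.2 hs.2.le
    gcongr
  rw [integral_rpow_mul_sub_rpow ha ha hT] at hI
  have hTp : 0 < T ^ (a - 1) := Real.rpow_pos_of_pos hT _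
  have e := abelResolvent_eq ha μ hT
  have hmul := mul_le_mul_of_nonneg_left hI (div_nonneg hμ hG.le)
  refine le_of_mul_le_mul_left ?_ hTp
  rw [abelResolvent] at e
  rw [e, mul_sub]
  have h2 : T ^ (a - 1) * (μ * T ^ a / Real.Gamma (a + a)) = μ / Real.Gamma a *
      (1 / Real.Gamma a *
        (T ^ (a + a - 1) * (Real.Gamma a * Real.Gamma a / Real.Gamma (a + a)))) := by
    rw [show a + a - 1 = (a - 1) + a by ring, Real.rpow_add hT]
    field_simp
  rw [h2, mul_one_div]
  linarith

/-- The bound by earlier values involves `((s + δ) / s) ^ (1 - a)`, which is at most 2 when `δ ≤ s`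
and then loses at most a quarter. For `s < δ`, the value at `s` is at most `1 / Γ(a) ≤ 1`, while the
bound near zero gives at least `1/2 - 1/4` at `2δ`. -/
theorem mittagLeffler₂_rpow_le_four_mul {a μ : ℝ} (ha : 1 / 2 ≤ a) (ha1 : a < 1) (hμ : 0 ≤ μ)
    {s δ : ℝ} (hs : 0 ≤ s) (hδ : 0 < δ) (hμδ : μ * δ ^ a ≤ 1 / 16) :
    mittagLeffler₂ a a (-μ * s ^ a) ≤ 4 * mittagLeffler₂ a a (-μ * (s + δ) ^ a) := by
  have ha0 : 0 < a := by linarith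
  have hH := mittagLeffler₂_rpow_pos ha0 ha1 hμ hs
  rcases le_or_gt δ s with h | h
  · have hs0 : 0 < s := hδ.trans_le h
    have key := sub_le_mittagLeffler₂_rpow ha0 ha1 hμ hs0 (lt_add_of_pos_right s hδ)
      (fun r hr => (mittagLeffler₂_rpow_pos ha0 ha1 hμ hr.1).le)
      (fun r hr => mittagLeffler₂_rpow_anti ha0 ha1 hμ hs0.le hr.1)
    rw [add_sub_cancel_left] at key
    have h1 : ((s + δ) / s) ^ (1 - a) ≤ 2 := by
      have h2 : (s + δ) / s ≤ 2 := by
        rw [div_le_iff₀ hs0]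
        linarith
      calc ((s + δ) / s) ^ (1 - a) ≤ 2 ^ (1 - a) :=
            Real.rpow_le_rpow (by positivity) h2 (by linarith)
        _ ≤ 2 ^ (1 : ℝ) := Real.rpow_le_rpow_of_exponent_le (by norm_num) (by linarith)
        _ = 2 := Real.rpow_one 2
    have hΓ := half_le_Gamma (x := a + 1) (by linarith) (by linarith)
    have h3 : ((s + δ) / s) ^ (1 - a) * (μ * δ ^ a) / Real.Gamma (a + 1) ≤ 1 / 4 := by
      rw [div_le_iff₀ (by linarith)]
      calc _ ≤ 2 * (1 / 16 : ℝ) := by gcongr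
        _ ≤ _ := by linarith
    nlinarith [mul_le_mul_of_nonneg_left h3 hH.le]
  · have h1 := sub_le_mittagLeffler₂_rpow_zero ha0 ha1 hμ (show 0 < 2 * δ by linarith)
    have h2 := mittagLeffler₂_rpow_anti ha0 ha1 hμ (show 0 ≤ s + δ by linarith)
      (show s + δ ≤ 2 * δ by linarith)
    have h3 := mittagLeffler₂_rpow_anti ha0 ha1 hμ le_rfl hs
    rw [Real.zero_rpow ha0.ne', mul_zero, mittagLeffler₂_zero ha0] at h3
    have hG1 := one_le_Gamma ha0 ha1.le
    have hG2 := half_le_Gamma (x := a + a) (by linarith) (by linarith)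
    have hG3 : Real.Gamma a ≤ 2 := by
      have := Gamma_le_one (x := a + 1) (by linarith) (by linarith)
      rw [Real.Gamma_add_one ha0.ne'] at this
      nlinarith
    have h4 : 1 / Real.Gamma a ≤ 1 := by
      rw [div_le_one (by linarith)]
      exact hG1
    have h5 : 1 / 2 ≤ 1 / Real.Gamma a := one_div_le_one_div_of_le (by linarith) hG3
    have h6 : μ * (2 * δ) ^ a / Real.Gamma (a + a) ≤ 1 / 4 := by
      rw [div_le_iff₀ (by linarith), Real.mul_rpow (by norm_num) hδ.le]
      have h7 : (2 : ℝ) ^ a ≤ 2 := by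
        calc (2 : ℝ) ^ a ≤ 2 ^ (1 : ℝ) :=
            Real.rpow_le_rpow_of_exponent_le (by norm_num) ha1.le
          _ = 2 := Real.rpow_one 2
      calc μ * (2 ^ a * δ ^ a) = 2 ^ a * (μ * δ ^ a) := by ring
        _ ≤ 2 * (1 / 16 : ℝ) := by gcongr
        _ ≤ _ := by linarith
    linarith

theorem mittagLeffler₂_rpow_le_of_sub_le {a μ : ℝ} (ha : 1 / 2 ≤ a) (ha1 : a < 1) (hμ : 0 ≤ μ)
    {s t : ℝ} (hs : 0 ≤ s) (hst : s < t) (hμδ : μ * (t - s) ^ a ≤ 1) :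
    mittagLeffler₂ a a (-μ * s ^ a) ≤ 4 ^ 256 * mittagLeffler₂ a a (-μ * t ^ a) := by
  have hts : 0 < t - s := sub_pos.2 hst
  -- Since `a ≥ 1/2`, `256 ^ a ≥ 16`; hence 256 substeps suffice for every such `a`.
  have hδ : μ * ((t - s) / 256) ^ a ≤ 1 / 16 := by
    rw [Real.div_rpow hts.le (by norm_num), ← mul_div_assoc]
    have : (16 : ℝ) ≤ 256 ^ a := by
      calc (16 : ℝ) = 256 ^ (1 / 2 : ℝ) := by
            rw [← Real.sqrt_eq_rpow, show (256 : ℝ) = 16 ^ 2 by norm_num,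
              Real.sqrt_sq (by norm_num)]
        _ ≤ 256 ^ a := Real.rpow_le_rpow_of_exponent_le (by norm_num) ha
    exact div_le_div₀ zero_le_one hμδ (by norm_num) this
  have key : ∀ m : ℕ, mittagLeffler₂ a a (-μ * s ^ a) ≤
      4 ^ m * mittagLeffler₂ a a (-μ * (s + m * ((t - s) / 256)) ^ a) := by
    intro m
    induction m with
    | zero => simp
    | succ m ih =>
      have h := mittagLeffler₂_rpow_le_four_mul ha ha1 hμ
        (s := s + m * ((t - s) / 256)) (by positivity) (div_pos hts (by norm_num)) hδ
      refine ih.trans ?_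
      rw [show s + ((m + 1 : ℕ) : ℝ) * ((t - s) / 256) =
        s + m * ((t - s) / 256) + (t - s) / 256 by push_cast; ring, pow_succ, mul_assoc]
      gcongr
  have h := key 256
  rwa [show s + ((256 : ℕ) : ℝ) * ((t - s) / 256) = t by push_cast; ring] at h

end FracGronwall

/-! ### Cell averages of the Abel kernel against the resolvent. -/

namespace FracGronwall

open MeasureTheory Set

/-- Chebyshev's integral inequality for oppositely ordered functions. -/
theorem sub_mul_integral_mul_le {f g : ℝ → ℝ} {x y : ℝ} (hxy : x ≤ y)
    (hf : IntervalIntegrable f volume x y) (hg : IntervalIntegrable g volume x y)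
    (hfg : IntervalIntegrable (fun s => f s * g s) volume x y)
    (h : ∀ s ∈ Ioo x y, ∀ r ∈ Ioo x y, (f s - f r) * (g s - g r) ≤ 0) :
    (y - x) * ∫ s in x..y, f s * g s ≤ (∫ s in x..y, f s) * ∫ s in x..y, g s := by
  set F := ∫ s in x..y, f s
  set G := ∫ s in x..y, g s
  set P := ∫ s in x..y, f s * g s
  -- The pointwise inequality integrated in `s` with `r` fixed; integrating in `r` then gives twice
  -- the claim.
  have inner : ∀ r ∈ Ioo x y, P + (y - x) * (f r * g r) ≤ F * g r + f r * G := by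
    intro r hr
    have h1 : ∫ s in x..y, (f s * g s + f r * g r) ≤ ∫ s in x..y, (f s * g r + f r * g s) := by
      refine intervalIntegral.integral_mono_on_of_le_Ioo hxy
        (hfg.add intervalIntegrable_const) ((hf.mul_const _).add (hg.const_mul _)) fun s hs => ?_
      nlinarith [h s hs r hr]
    rwa [intervalIntegral.integral_add hfg intervalIntegrable_const,
      intervalIntegral.integral_add (hf.mul_const _) (hg.const_mul _),
      intervalIntegral.integral_const, intervalIntegral.integral_mul_const,
      intervalIntegral.integral_const_mul, smul_eq_mul] at h1
  have h2 : ∫ r in x..y, (P + (y - x) * (f r * g r)) ≤ ∫ r in x..y, (F * g r + f r * G) :=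
    intervalIntegral.integral_mono_on_of_le_Ioo hxy
      (intervalIntegrable_const.add (hfg.const_mul _)) ((hg.const_mul _).add (hf.mul_const _)) inner
  rw [intervalIntegral.integral_add intervalIntegrable_const (hfg.const_mul _),
      intervalIntegral.integral_add (hg.const_mul _) (hf.mul_const _),
      intervalIntegral.integral_const, intervalIntegral.integral_mul_const,
      intervalIntegral.integral_const_mul, intervalIntegral.integral_const_mul, smul_eq_mul] at h2
  linarith

/-- The slope is taken at the larger point `p`, so the bound survives `q = 0`. Lacking a factor `e`,
it produces `1 / e` after integration of `s ^ (e - 1)`: the origin of `1 / (1 - a)`. -/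
theorem rpow_sub_rpow_le {p q e : ℝ} (hq : 0 ≤ q) (hqp : q ≤ p) (hp : 0 < p) (he : 0 < e)
    (he1 : e ≤ 1) : p ^ e - q ^ e ≤ p ^ (e - 1) * (p - q) := by
  have h1 : p ^ (e - 1) * p = p ^ e := by
    rw [← Real.rpow_add_one hp.ne', sub_add_cancel]
  have h2 : p ^ (e - 1) * q ≤ q ^ e := by
    rcases hq.eq_or_lt with rfl | hq
    · simp [Real.zero_rpow he.ne']
    · calc p ^ (e - 1) * q ≤ q ^ (e - 1) * q := by
            gcongr ?_ * q
            exact Real.rpow_le_rpow_of_nonpos hq hqp (by linarith)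
        _ = q ^ e := by rw [← Real.rpow_add_one hq.ne', sub_add_cancel]
  linarith

section Kernel

variable {a μ T x y : ℝ}

theorem abelKernel_sub_eq {s : ℝ} (hs : s < T) :
    abelKernel (1 - a) (T - s) = (T - s) ^ ((1 - a) - 1) / Real.Gamma (1 - a) := by
  rw [abelKernel, if_pos (sub_pos.2 hs)]

theorem abelKernel_sub_nonneg (ha1 : a < 1) (s : ℝ) : 0 ≤ abelKernel (1 - a) (T - s) := by
  rw [abelKernel]
  split_ifs with h
  · exact div_nonneg (Real.rpow_nonneg h.le _) (Real.Gamma_pos_of_pos (by linarith)).le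
  · exact le_rfl

theorem abelKernel_sub_mono (ha : 0 < a) (ha1 : a < 1) {s r : ℝ} (hsr : s ≤ r) (hr : r < T) :
    abelKernel (1 - a) (T - s) ≤ abelKernel (1 - a) (T - r) := by
  rw [abelKernel_sub_eq hr, abelKernel_sub_eq (hsr.trans_lt hr)]
  have := Real.Gamma_pos_of_pos (show 0 < 1 - a by linarith)
  exact div_le_div_of_nonneg_right
    (Real.rpow_le_rpow_of_nonpos (by linarith) (by linarith) (by linarith)) this.le

theorem intervalIntegrable_sub_rpow (ha1 : a < 1) :
    IntervalIntegrable (fun s => (T - s) ^ ((1 - a) - 1)) volume x y := by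
  have := (intervalIntegral.intervalIntegrable_rpow' (a := T - x) (b := T - y)
      (show -1 < (1 - a) - 1 by linarith)).comp_sub_left T
  simpa using this

theorem intervalIntegrable_abelKernel_sub (ha1 : a < 1) (hxy : x ≤ y) (hyT : y ≤ T) :
    IntervalIntegrable (fun s => abelKernel (1 - a) (T - s)) volume x y := by
  refine ((intervalIntegrable_sub_rpow (T := T) ha1).div_const (Real.Gamma (1 - a))).congr_uIoo ?_
  intro s hs
  rw [uIoo_of_le hxy] at hs
  exact (abelKernel_sub_eq (hs.2.trans_le hyT)).symm

theorem integral_abelKernel_sub_le (ha : 0 < a) (ha1 : a < 1) (hxy : x < y) (hyT : y ≤ T) :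
    ∫ s in x..y, abelKernel (1 - a) (T - s) ≤
      1 / (1 - a) * abelKernel (1 - a) (T - x) * (y - x) := by
  have h1 : ∫ s in x..y, abelKernel (1 - a) (T - s) =
      ∫ s in x..y, (T - s) ^ ((1 - a) - 1) / Real.Gamma (1 - a) := by
    refine intervalIntegral.integral_congr_uIoo fun s hs => ?_
    rw [uIoo_of_le hxy.le] at hs
    exact abelKernel_sub_eq (hs.2.trans_le hyT)
  have hG := Real.Gamma_pos_of_pos (show 0 < 1 - a by linarith)
  rw [h1, abelKernel_sub_eq (hxy.trans_le hyT), intervalIntegral.integral_div,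
    intervalIntegral.integral_comp_sub_left (fun s => s ^ ((1 - a) - 1)) T,
    integral_rpow (Or.inl (by linarith)), sub_add_cancel]
  have h2 := rpow_sub_rpow_le (p := T - x) (q := T - y) (e := 1 - a) (by linarith) (by linarith)
    (by linarith) (by linarith) (by linarith)
  have h1a : 0 < 1 - a := by linarith
  calc ((T - x) ^ (1 - a) - (T - y) ^ (1 - a)) / (1 - a) / Real.Gamma (1 - a)
      ≤ ((T - x) ^ (1 - a - 1) * (T - x - (T - y))) / (1 - a) / Real.Gamma (1 - a) := by gcongr
    _ = _ := by
      field_simp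
      ring

/-- Orders `a` and `1 - a` add up to 1. Together with `mittagLeffler_sub_eq`, this says that `E_a(-μ
t^a)` has Caputo derivative `-μ E_a(-μ t^a)`. -/
theorem abelKernel_mul_abelResolvent (ha : 0 < a) (ha1 : a < 1) (hT : 0 < T) :
    IntervalIntegrable (fun s => abelKernel (1 - a) (T - s) * abelResolvent a μ s) volume 0 T ∧
    ∫ s in (0 : ℝ)..T, abelKernel (1 - a) (T - s) * abelResolvent a μ s =
      mittagLeffler a (-(μ * T ^ a)) := by
  have hG := (Real.Gamma_pos_of_pos (show 0 < 1 - a by linarith)).ne'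
  obtain ⟨h1, h2⟩ := integral_mittagLeffler₂_mul_sub_rpow ha ha (show 0 < 1 - a by linarith) hT (-μ)
  have heq : EqOn (fun s => s ^ (a - 1) * mittagLeffler₂ a a (-μ * s ^ a) *
      (T - s) ^ (1 - a - 1) / Real.Gamma (1 - a))
      (fun s => abelKernel (1 - a) (T - s) * abelResolvent a μ s) (uIoo 0 T) := by
    intro s hs
    rw [uIoo_of_le hT.le] at hs
    simp only [abelKernel_sub_eq hs.2, abelResolvent]
    ring
  refine ⟨(h1.div_const _).congr_uIoo heq, ?_⟩
  rw [← intervalIntegral.integral_congr_uIoo heq, intervalIntegral.integral_div, h2,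
    show a + (1 - a) = 1 by ring, sub_self, Real.rpow_zero, mittagLeffler, neg_mul]
  field_simp

theorem mul_integral_abelResolvent_zero (ha : 0 < a) (hT : 0 ≤ T) :
    μ * ∫ s in (0 : ℝ)..T, abelResolvent a μ s = 1 - mittagLeffler a (-(μ * T ^ a)) := by
  rcases hT.eq_or_lt with rfl | hT
  · simp [mittagLeffler, Real.zero_rpow ha.ne', mittagLeffler₂_zero ha]
  have h := (integral_mittagLeffler₂_mul_sub_rpow ha ha one_pos hT (-μ)).2
  simp only [sub_self, Real.rpow_zero, mul_one, Real.Gamma_one, one_mul, add_sub_cancel_right] at h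
  simp only [abelResolvent, mittagLeffler]
  rw [h, mittagLeffler₂_eq_add ha 1, Real.Gamma_one, neg_mul]
  ring

theorem mittagLeffler_sub_eq (ha : 0 < a) (hx : 0 ≤ x) (hy : 0 ≤ y) :
    mittagLeffler a (-(μ * y ^ a)) - mittagLeffler a (-(μ * x ^ a)) =
      -(μ * ∫ s in x..y, abelResolvent a μ s) := by
  have h1 := mul_integral_abelResolvent_zero (μ := μ) ha hx
  have h2 := mul_integral_abelResolvent_zero (μ := μ) ha hy
  rw [← intervalIntegral.integral_add_adjacent_intervals
    (intervalIntegrable_abelResolvent ha μ 0 x) (intervalIntegrable_abelResolvent ha μ x y),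
    mul_add] at h2
  linarith

theorem intervalIntegrable_abelKernel_mul (ha : 0 < a) (ha1 : a < 1) (hx : 0 ≤ x) (hxy : x < y)
    (hyT : y ≤ T) :
    IntervalIntegrable (fun s => abelKernel (1 - a) (T - s) * abelResolvent a μ s) volume x y :=
  (abelKernel_mul_abelResolvent ha ha1 (hx.trans_lt (hxy.trans_le hyT))).1.mono_set (by
    rw [uIcc_of_le hxy.le, uIcc_of_le (hx.trans (hxy.le.trans hyT))]
    exact Icc_subset_Icc hx hyT)

/-- Replacing the Abel kernel by its mean over an interval increases its integral against the
resolvent. -/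
theorem integral_mul_le_average_mul (ha : 0 < a) (ha1 : a < 1) (hμ : 0 ≤ μ) (hx : 0 ≤ x)
    (hxy : x < y) (hyT : y ≤ T) :
    ∫ s in x..y, abelKernel (1 - a) (T - s) * abelResolvent a μ s ≤
      (1 / (y - x) * ∫ s in x..y, abelKernel (1 - a) (T - s)) *
        ∫ s in x..y, abelResolvent a μ s := by
  have h := sub_mul_integral_mul_le hxy.le (intervalIntegrable_abelKernel_sub ha1 hxy.le hyT)
    (intervalIntegrable_abelResolvent ha μ x y)
    (intervalIntegrable_abelKernel_mul ha ha1 hx hxy hyT) (by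
      have key : ∀ s ∈ Ioo x y, ∀ r ∈ Ioo x y, s ≤ r →
          (abelKernel (1 - a) (T - s) - abelKernel (1 - a) (T - r)) *
            (abelResolvent a μ s - abelResolvent a μ r) ≤ 0 := fun s hs r hr hsr =>
        mul_nonpos_of_nonpos_of_nonneg
          (sub_nonpos.2 (abelKernel_sub_mono ha ha1 hsr (hr.2.trans_le hyT)))
          (sub_nonneg.2 (abelResolvent_anti ha ha1 hμ (hx.trans_lt hs.1) hsr))
      intro s hs r hr
      rcases le_total s r with hsr | hrs
      · exact key s hs r hr hsr
      · linarith [key r hr s hs hrs])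
  have hpos : 0 < y - x := sub_pos.2 hxy
  rw [one_div, mul_assoc, inv_mul_eq_div, le_div_iff₀ hpos]
  linarith

theorem integral_abelResolvent_nonneg (ha : 0 < a) (ha1 : a < 1) (hμ : 0 ≤ μ) (hx : 0 ≤ x)
    (hxy : x ≤ y) : 0 ≤ ∫ s in x..y, abelResolvent a μ s :=
  intervalIntegral.integral_nonneg hxy fun _ hs => abelResolvent_nonneg ha ha1 hμ (hx.trans hs.1)

/-- The mean of the kernel is at most `1 / (1 - a)` times its value at the left end `x`, which is
its minimum on the cell. -/
theorem average_mul_le_inv_mul (ha : 0 < a) (ha1 : a < 1) (hμ : 0 ≤ μ) (hx : 0 ≤ x)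
    (hxy : x < y) (hyT : y ≤ T) :
    (1 / (y - x) * ∫ s in x..y, abelKernel (1 - a) (T - s)) * ∫ s in x..y, abelResolvent a μ s ≤
      1 / (1 - a) * ∫ s in x..y, abelKernel (1 - a) (T - s) * abelResolvent a μ s := by
  have hpos : 0 < y - x := sub_pos.2 hxy
  have h1a : 0 < 1 - a := by linarith
  have h1 : abelKernel (1 - a) (T - x) * ∫ s in x..y, abelResolvent a μ s ≤
      ∫ s in x..y, abelKernel (1 - a) (T - s) * abelResolvent a μ s := by
    rw [← intervalIntegral.integral_const_mul]
    refine intervalIntegral.integral_mono_on_of_le_Ioo hxy.le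
      ((intervalIntegrable_abelResolvent ha μ x y).const_mul _)
      (intervalIntegrable_abelKernel_mul ha ha1 hx hxy hyT) fun s hs => ?_
    exact mul_le_mul_of_nonneg_right (abelKernel_sub_mono ha ha1 hs.1.le (hs.2.trans_le hyT))
      (abelResolvent_nonneg ha ha1 hμ (hx.trans hs.1.le))
  have h2 := integral_abelResolvent_nonneg ha ha1 hμ hx hxy.le
  calc _ ≤ (1 / (y - x) * (1 / (1 - a) * abelKernel (1 - a) (T - x) * (y - x))) *
        ∫ s in x..y, abelResolvent a μ s := by
        gcongr
        exact integral_abelKernel_sub_le ha ha1 hxy hyT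
    _ = 1 / (1 - a) * (abelKernel (1 - a) (T - x) * ∫ s in x..y, abelResolvent a μ s) := by
        field_simp
    _ ≤ _ := by gcongr

/-- The power factor costs `1 / a ≤ 2`, the Mittag-Leffler factor the Harnack constant. -/
theorem integral_abelResolvent_le (ha : 1 / 2 ≤ a) (ha1 : a < 1) (hμ : 0 ≤ μ) (hx : 0 ≤ x)
    (hxy : x < y) (hstep : μ * (y - x) ^ a ≤ 1) :
    ∫ s in x..y, abelResolvent a μ s ≤ 2 * 4 ^ 256 * ((y - x) * abelResolvent a μ y) := by
  have ha0 : 0 < a := by linarith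
  have hpos : 0 < y - x := sub_pos.2 hxy
  have hy : 0 < y := hx.trans_lt hxy
  have hH := mittagLeffler₂_rpow_pos ha0 ha1 hμ hx
  have h1 : ∫ s in x..y, abelResolvent a μ s ≤
      (∫ s in x..y, s ^ (a - 1)) * mittagLeffler₂ a a (-μ * x ^ a) := by
    rw [← intervalIntegral.integral_mul_const]
    refine intervalIntegral.integral_mono_on_of_le_Ioo hxy.le
      (intervalIntegrable_abelResolvent ha0 μ x y)
      ((intervalIntegral.intervalIntegrable_rpow' (by linarith)).mul_const _) fun s hs => ?_
    exact mul_le_mul_of_nonneg_left (mittagLeffler₂_rpow_anti ha0 ha1 hμ hx hs.1.le)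
      (Real.rpow_nonneg (hx.trans hs.1.le) _)
  have h2 : ∫ s in x..y, s ^ (a - 1) ≤ 2 * (y ^ (a - 1) * (y - x)) := by
    rw [integral_rpow (Or.inl (by linarith)), sub_add_cancel, div_le_iff₀ ha0]
    have h3 := rpow_sub_rpow_le hx hxy.le hy ha0 ha1.le
    have h4 : 0 ≤ y ^ (a - 1) * (y - x) := by positivity
    nlinarith
  calc _ ≤ _ := h1
    _ ≤ 2 * (y ^ (a - 1) * (y - x)) * (4 ^ 256 * mittagLeffler₂ a a (-μ * y ^ a)) := by
        have := mittagLeffler₂_rpow_le_of_sub_le ha ha1 hμ hx hxy hstep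
        gcongr
    _ = _ := by
        rw [abelResolvent]
        ring

/-- For `a ≥ 1/2` the mean of the resolvent is compared with its minimum, at `y`; for `a < 1/2` the
constant `1 / (1 - a) ≤ 2` is already good enough. -/
theorem average_mul_le_const_mul (ha : 0 < a) (ha1 : a < 1) (hμ : 0 ≤ μ) (hx : 0 ≤ x)
    (hxy : x < y) (hyT : y ≤ T) (hstep : μ * (y - x) ^ a ≤ 1) :
    (1 / (y - x) * ∫ s in x..y, abelKernel (1 - a) (T - s)) * ∫ s in x..y, abelResolvent a μ s ≤
      2 * 4 ^ 256 * ∫ s in x..y, abelKernel (1 - a) (T - s) * abelResolvent a μ s := by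
  have hnn : 0 ≤ ∫ s in x..y, abelKernel (1 - a) (T - s) * abelResolvent a μ s :=
    intervalIntegral.integral_nonneg hxy.le fun s hs =>
      mul_nonneg (abelKernel_sub_nonneg ha1 s) (abelResolvent_nonneg ha ha1 hμ (hx.trans hs.1))
  rcases le_or_gt (1 / 2) a with h | h
  · have hpos : 0 < y - x := sub_pos.2 hxy
    have hg : 0 ≤ ∫ s in x..y, abelKernel (1 - a) (T - s) :=
      intervalIntegral.integral_nonneg hxy.le fun s _ => abelKernel_sub_nonneg ha1 s
    have h1 : (∫ s in x..y, abelKernel (1 - a) (T - s)) * abelResolvent a μ y ≤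
        ∫ s in x..y, abelKernel (1 - a) (T - s) * abelResolvent a μ s := by
      rw [← intervalIntegral.integral_mul_const]
      refine intervalIntegral.integral_mono_on_of_le_Ioo hxy.le
        ((intervalIntegrable_abelKernel_sub ha1 hxy.le hyT).mul_const _)
        (intervalIntegrable_abelKernel_mul ha ha1 hx hxy hyT) fun s hs => ?_
      exact mul_le_mul_of_nonneg_left (abelResolvent_anti ha ha1 hμ (hx.trans_lt hs.1) hs.2.le)
        (abelKernel_sub_nonneg ha1 s)
    calc _ ≤ (1 / (y - x) * ∫ s in x..y, abelKernel (1 - a) (T - s)) *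
          (2 * 4 ^ 256 * ((y - x) * abelResolvent a μ y)) := by
          gcongr
          exact integral_abelResolvent_le h ha1 hμ hx hxy hstep
      _ = 2 * 4 ^ 256 * ((∫ s in x..y, abelKernel (1 - a) (T - s)) * abelResolvent a μ y) := by
          field_simp
      _ ≤ _ := by gcongr
  · refine (average_mul_le_inv_mul ha ha1 hμ hx hxy hyT).trans ?_
    refine mul_le_mul_of_nonneg_right ?_ hnn
    calc 1 / (1 - a) ≤ 2 := by
          rw [div_le_iff₀ (by linarith)]
          linarith
      _ = 2 * 1 := (mul_one 2).symm
      _ ≤ 2 * 4 ^ 256 := by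
          gcongr
          exact one_le_pow₀ (by norm_num)

end Kernel

/-! ### Sampled Mittag-Leffler functions as discrete sub- and supersolutions. -/

theorem IsGrid.mono {N : ℕ∞} {t : ℕ → ℝ} (ht : IsGrid N t) {i j : ℕ} (hij : i ≤ j)
    (hj : (j : ℕ∞) ≤ N) : t i ≤ t j := by
  induction j, hij using Nat.le_induction with
  | base => exact le_rfl
  | succ j hij ih =>
    exact (ih (le_trans (by exact_mod_cast j.le_succ) hj)).trans
      (ht.lt (j + 1) (by omega) hj).le

theorem IsGrid.nonneg {N : ℕ∞} {t : ℕ → ℝ} (ht : IsGrid N t) {j : ℕ} (hj : (j : ℕ∞) ≤ N) :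
    0 ≤ t j :=
  ht.zero.symm.le.trans (ht.mono (Nat.zero_le j) hj)

section Scheme

variable {a : ℝ} {N : ℕ∞} {t : ℕ → ℝ} {C : ArrayKernel} {μ : ℝ}

theorem IsGrid.interval {n j : ℕ} (ht : IsGrid N t) (hn : (n : ℕ∞) ≤ N)
    (hj : j ∈ Finset.Icc 1 n) : 0 ≤ t (j - 1) ∧ t (j - 1) < t j ∧ t j ≤ t n := by
  obtain ⟨h1, h2⟩ := Finset.mem_Icc.1 hj
  have hjN : (j : ℕ∞) ≤ N := le_trans (by exact_mod_cast h2) hn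
  exact ⟨ht.nonneg (le_trans (by exact_mod_cast j.sub_le 1) hjN), ht.lt j h1 hjN, ht.mono h2 hn⟩

theorem sum_integral_grid (ha : 0 < a) (ha1 : a < 1) (ht : IsGrid N t) {n : ℕ} (hn1 : 1 ≤ n)
    (hn : (n : ℕ∞) ≤ N) :
    ∑ j ∈ Finset.Icc 1 n, ∫ s in (t (j - 1))..(t j),
      abelKernel (1 - a) (t n - s) * abelResolvent a μ s = mittagLeffler a (-(μ * t n ^ a)) := by
  have hT : 0 < t n := (ht.nonneg (le_trans (by exact_mod_cast n.sub_le 1) hn)).trans_lt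
    (ht.lt n hn1 hn)
  rw [← (abelKernel_mul_abelResolvent ha ha1 hT).2]
  have key : ∀ m ≤ n, ∑ j ∈ Finset.Icc 1 m, ∫ s in (t (j - 1))..(t j),
      abelKernel (1 - a) (t n - s) * abelResolvent a μ s =
      ∫ s in (0 : ℝ)..t m, abelKernel (1 - a) (t n - s) * abelResolvent a μ s := by
    intro m
    induction m with
    | zero => intro _; simp [ht.zero]
    | succ m ih =>
      intro hm
      obtain ⟨h0, h1, h2⟩ := ht.interval hn (Finset.mem_Icc.2 ⟨by omega, hm⟩ :
        m + 1 ∈ Finset.Icc 1 n)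
      rw [Nat.add_sub_cancel] at h0 h1
      rw [Finset.sum_Icc_succ_top (by omega), ih (by omega), Nat.add_sub_cancel]
      refine intervalIntegral.integral_add_adjacent_intervals
        ((abelKernel_mul_abelResolvent ha ha1 hT).1.mono_set ?_)
        (intervalIntegrable_abelKernel_mul ha ha1 h0 h1 h2)
      rw [uIcc_of_le h0, uIcc_of_le hT.le]
      exact Icc_subset_Icc_right (h1.le.trans h2)
  exact key n le_rfl

theorem discreteDeriv_mittagLeffler (ha : 0 < a) (ht : IsGrid N t) {n : ℕ} (hn : (n : ℕ∞) ≤ N) :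
    discreteDeriv C (fun k => mittagLeffler a (-(μ * t k ^ a))) n =
      -(μ * ∑ j ∈ Finset.Icc 1 n,
        C n (n - j) * ∫ s in (t (j - 1))..(t j), abelResolvent a μ s) := by
  rw [discreteDeriv, Finset.mul_sum, ← Finset.sum_neg_distrib]
  refine Finset.sum_congr rfl fun j hj => ?_
  obtain ⟨h0, h1, -⟩ := ht.interval hn hj
  rw [mittagLeffler_sub_eq ha h0 (h0.trans h1.le)]
  ring

theorem discreteDeriv_mittagLeffler_le (ha : 0 < a) (ha1 : a < 1) (ht : IsGrid N t) {ν : ℝ}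
    (hν : 0 ≤ ν) (hμ : 0 ≤ μ) (hC : KernelLowerBound a N t C ν) {n : ℕ} (hn1 : 1 ≤ n)
    (hn : (n : ℕ∞) ≤ N) :
    discreteDeriv C (fun k => mittagLeffler a (-(μ * t k ^ a))) n ≤
      -(μ * ν) * mittagLeffler a (-(μ * t n ^ a)) := by
  rw [discreteDeriv_mittagLeffler ha ht hn, ← sum_integral_grid ha ha1 ht hn1 hn, neg_mul,
    mul_assoc, Finset.mul_sum _ _ ν]
  refine neg_le_neg (mul_le_mul_of_nonneg_left (Finset.sum_le_sum fun j hj => ?_) hμ)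
  obtain ⟨h0, h1, h2⟩ := ht.interval hn hj
  obtain ⟨hj1, hjn⟩ := Finset.mem_Icc.1 hj
  calc _ ≤ ν * (kernelAverage a t n j * ∫ s in (t (j - 1))..(t j), abelResolvent a μ s) :=
        mul_le_mul_of_nonneg_left (integral_mul_le_average_mul ha ha1 hμ h0 h1 h2) hν
    _ = ν * kernelAverage a t n j * ∫ s in (t (j - 1))..(t j), abelResolvent a μ s := by ring
    _ ≤ _ := mul_le_mul_of_nonneg_right (hC n j hj1 hjn hn)
        (integral_abelResolvent_nonneg ha ha1 hμ h0 h1.le)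

/-- `K` is left abstract so that both estimates of part (2) follow, with `K = 1 / (1 - a)` and `K =
σ`. -/
theorem le_discreteDeriv_mittagLeffler (ha : 0 < a) (ha1 : a < 1) (ht : IsGrid N t) {ρ K : ℝ}
    (hρ : 0 ≤ ρ) (hμ : 0 ≤ μ) (hC : KernelUpperBound a N t C ρ)
    (hK : ∀ n j : ℕ, (n : ℕ∞) ≤ N → j ∈ Finset.Icc 1 n →
      kernelAverage a t n j * ∫ s in (t (j - 1))..(t j), abelResolvent a μ s ≤
        K * ∫ s in (t (j - 1))..(t j), abelKernel (1 - a) (t n - s) * abelResolvent a μ s)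
    {n : ℕ} (hn1 : 1 ≤ n) (hn : (n : ℕ∞) ≤ N) :
    -(μ * (ρ * K)) * mittagLeffler a (-(μ * t n ^ a)) ≤
      discreteDeriv C (fun k => mittagLeffler a (-(μ * t k ^ a))) n := by
  rw [discreteDeriv_mittagLeffler ha ht hn, ← sum_integral_grid ha ha1 ht hn1 hn, neg_mul,
    mul_assoc, Finset.mul_sum _ _ (ρ * K)]
  refine neg_le_neg (mul_le_mul_of_nonneg_left (Finset.sum_le_sum fun j hj => ?_) hμ)
  obtain ⟨h0, h1, h2⟩ := ht.interval hn hj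
  obtain ⟨hj1, hjn⟩ := Finset.mem_Icc.1 hj
  calc _ ≤ ρ * kernelAverage a t n j * ∫ s in (t (j - 1))..(t j), abelResolvent a μ s :=
        mul_le_mul_of_nonneg_right (hC n j hj1 hjn hn)
          (integral_abelResolvent_nonneg ha ha1 hμ h0 h1.le)
    _ = ρ * (kernelAverage a t n j * ∫ s in (t (j - 1))..(t j), abelResolvent a μ s) := by ring
    _ ≤ ρ * _ := mul_le_mul_of_nonneg_left (hK n j hn hj) hρ
    _ = _ := by ring

/-- A nonnegative multiple of a discrete supersolution of the homogeneous relaxation equation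
dominates every subsolution of the inhomogeneous one. -/
theorem IsMonotoneKernel.le_of_supersolution (hC : IsMonotoneKernel N C) {lam c : ℝ}
    (hlam : 0 < lam) {v φ : ℕ → ℝ} (h0 : c / lam < v 0) (hφ0 : φ 0 = 1)
    (hφ : ∀ n : ℕ, 1 ≤ n → (n : ℕ∞) ≤ N → -lam * φ n ≤ discreteDeriv C φ n)
    (hv : ∀ n : ℕ, 1 ≤ n → (n : ℕ∞) ≤ N → discreteDeriv C v n ≤ -lam * v n + c) (n : ℕ)
    (hn : (n : ℕ∞) ≤ N) : v n ≤ (v 0 - c / lam) * φ n + c / lam := by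
  refine sub_nonneg.1 (hC.nonneg_of_le_discreteDeriv hlam
    (w := fun k => (v 0 - c / lam) * φ k + c / lam - v k) (by simp [hφ0]) ?_ n hn)
  intro n hn1 hn
  rw [discreteDeriv_sub C (fun k => (v 0 - c / lam) * φ k + c / lam), discreteDeriv_add_const,
    discreteDeriv_const_mul]
  -- Positivity of `v 0 - c / λ` preserves the inequality for `φ`; the shift by `c / λ` has zero
  -- discrete derivative and absorbs `c`.
  have h1 := mul_le_mul_of_nonneg_left (hφ n hn1 hn) (sub_pos.2 h0).le
  have h2 := hv n hn1 hn
  have h3 : lam * (c / lam) = c := by field_simp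
  linarith

theorem IsMonotoneKernel.le_of_subsolution (hC : IsMonotoneKernel N C) {lam c : ℝ}
    (hlam : 0 < lam) {v φ : ℕ → ℝ} (h0 : c / lam < v 0) (hφ0 : φ 0 = 1)
    (hφ : ∀ n : ℕ, 1 ≤ n → (n : ℕ∞) ≤ N → discreteDeriv C φ n ≤ -lam * φ n)
    (hv : ∀ n : ℕ, 1 ≤ n → (n : ℕ∞) ≤ N → -lam * v n + c ≤ discreteDeriv C v n) (n : ℕ)
    (hn : (n : ℕ∞) ≤ N) : (v 0 - c / lam) * φ n + c / lam ≤ v n := by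
  refine sub_nonneg.1 (hC.nonneg_of_le_discreteDeriv hlam
    (w := fun k => v k - ((v 0 - c / lam) * φ k + c / lam)) (by simp [hφ0]) ?_ n hn)
  intro n hn1 hn
  rw [discreteDeriv_sub C v (fun k => (v 0 - c / lam) * φ k + c / lam), discreteDeriv_add_const,
    discreteDeriv_const_mul]
  have h1 := mul_le_mul_of_nonneg_left (hφ n hn1 hn) (sub_pos.2 h0).le
  have h2 := hv n hn1 hn
  have h3 : lam * (c / lam) = c := by field_simp
  linarith

theorem mittagLeffler_grid_zero (ha : 0 < a) (ht : IsGrid N t) :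
    mittagLeffler a (-(μ * t 0 ^ a)) = 1 := by
  rw [ht.zero, Real.zero_rpow ha.ne', mul_zero, neg_zero, mittagLeffler, mittagLeffler₂_zero ha,
    Real.Gamma_one, div_one]

end Scheme

end FracGronwall

/-! ### The theorem: choice of the decay rates. -/

theorem theorem4p2 :
    ∃ σ : ℝ, 1 < σ ∧
      ∀ (α : ℝ), 0 < α → α < 1 →
      ∀ (N : ℕ∞) (t : ℕ → ℝ), FracGronwall.IsGrid N t →
      ∀ (C : FracGronwall.ArrayKernel), FracGronwall.CompletelyPositiveScheme N C →
      ∀ (lam c : ℝ), 0 < lam →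
      ∀ (v : ℕ → ℝ), (∀ n : ℕ, (n : ℕ∞) ≤ N → 0 ≤ v n) → c / lam < v 0 →
        (∀ ν : ℝ, 0 < ν → FracGronwall.KernelLowerBound α N t C ν →
          (∀ n : ℕ, 1 ≤ n → (n : ℕ∞) ≤ N →
            -lam * v n + c ≤ FracGronwall.discreteDeriv C v n) →
          ∀ n : ℕ, (n : ℕ∞) ≤ N →
            (v 0 - c / lam) * FracGronwall.mittagLeffler α (-(ν⁻¹ * lam * t n ^ α)) + c / lam
              ≤ v n) ∧
        (∀ ρ₁ : ℝ, 0 < ρ₁ → FracGronwall.KernelUpperBound α N t C ρ₁ →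
          (∀ n : ℕ, 1 ≤ n → (n : ℕ∞) ≤ N →
            FracGronwall.discreteDeriv C v n ≤ -lam * v n + c) →
          (∀ n : ℕ, (n : ℕ∞) ≤ N →
            v n ≤ (v 0 - c / lam) *
                FracGronwall.mittagLeffler α (-(lam * (1 - α) / ρ₁ * t n ^ α)) + c / lam) ∧
          ((∀ n : ℕ, 1 ≤ n → (n : ℕ∞) ≤ N → lam * FracGronwall.step t n ^ α ≤ 1) →
            1 ≤ σ * ρ₁ →
            ∀ n : ℕ, (n : ℕ∞) ≤ N →
              v n ≤ (v 0 - c / lam) *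
                  FracGronwall.mittagLeffler α (-(lam / (σ * ρ₁) * t n ^ α)) + c / lam)) := by
  obtain ⟨σ, hσ⟩ : ∃ σ : ℝ, σ = 2 * 4 ^ 256 := ⟨_, rfl⟩
  have hσ1 : 1 < σ := by
    have : (1 : ℝ) ≤ 4 ^ 256 := one_le_pow₀ (by norm_num)
    linarith
  refine ⟨σ, hσ1, ?_⟩
  intro α hα hα1 N t ht C hC lam c hlam v _ hv0
  have hM := hC.isMonotoneKernel
  refine ⟨fun ν hν hlow hv n hn => ?_,
    fun ρ hρ hup hv => ⟨fun n hn => ?_, fun hstep hσρ n hn => ?_⟩⟩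
  · refine hM.le_of_subsolution hlam
      (φ := fun k => FracGronwall.mittagLeffler α (-(ν⁻¹ * lam * t k ^ α))) hv0
      (FracGronwall.mittagLeffler_grid_zero hα ht)
      (fun n hn1 hn => ?_) hv n hn
    have h := FracGronwall.discreteDeriv_mittagLeffler_le hα hα1 ht hν.le
      (μ := ν⁻¹ * lam) (by positivity) hlow hn1 hn
    rwa [show ν⁻¹ * lam * ν = lam by field_simp] at h
  · have h1α : 0 < 1 - α := by linarith
    have hμ : 0 ≤ lam * (1 - α) / ρ := by positivity
    refine hM.le_of_supersolution hlam
      (φ := fun k => FracGronwall.mittagLeffler α (-(lam * (1 - α) / ρ * t k ^ α))) hv0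
      (FracGronwall.mittagLeffler_grid_zero hα ht)
      (fun n hn1 hn => ?_) hv n hn
    have h := FracGronwall.le_discreteDeriv_mittagLeffler hα hα1 ht hρ.le hμ hup
      (K := 1 / (1 - α)) (fun n j hn hj => by
        obtain ⟨h0, h1, h2⟩ := ht.interval hn hj
        exact FracGronwall.average_mul_le_inv_mul hα hα1 hμ h0 h1 h2) hn1 hn
    rwa [show lam * (1 - α) / ρ * (ρ * (1 / (1 - α))) = lam by field_simp] at h
  · have hσ0 : 0 < σ := zero_lt_one.trans hσ1
    have hμ : 0 ≤ lam / (σ * ρ) := by positivity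
    refine hM.le_of_supersolution hlam
      (φ := fun k => FracGronwall.mittagLeffler α (-(lam / (σ * ρ) * t k ^ α))) hv0
      (FracGronwall.mittagLeffler_grid_zero hα ht)
      (fun n hn1 hn => ?_) hv n hn
    have h := FracGronwall.le_discreteDeriv_mittagLeffler hα hα1 ht hρ.le hμ hup
      (K := σ) (fun n j hn hj => by
        obtain ⟨h0, h1, h2⟩ := ht.interval hn hj
        obtain ⟨hj1, hjn⟩ := Finset.mem_Icc.1 hj
        have hs := hstep j hj1 (le_trans (by exact_mod_cast hjn) hn)
        rw [hσ]
        -- The cell estimate needs `μ τ^α ≤ 1` with `μ = λ / (σ ρ)`; since `σ ρ ≥ 1`, `μ ≤ λ` and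
        -- the step condition on `λ` suffices.
        refine FracGronwall.average_mul_le_const_mul hα hα1 (hσ ▸ hμ) h0 h1 h2 (le_trans ?_ hs)
        rw [← hσ]
        exact mul_le_mul_of_nonneg_right (div_le_self hlam.le hσρ)
          (Real.rpow_nonneg (sub_pos.2 h1).le _)) hn1 hn
    rwa [show lam / (σ * ρ) * (ρ * σ) = lam by field_simp] at h
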